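/- Let $\Omega\subset\mathbb R^3$ be a bounded open set, $T>0$, $N\in\mathbb N$. For $\mathbb C^N$-valued $f,g$ on $\Omega$ write $(f,g)=\int_\Omega\sum_j f_j\overline{g_j}\,dx$. Let $H^1_0=H^1_0(\Omega;\mathbb C^N)$, let $H^{-1}$ be the space of bounded antilinear functionals on $H^1_0$, $L^2=L^2(\Omega;\mathbb C^N)$, $X=L^2(0,T;H^1_0)$, $X^*=L^2(0,T;H^{-1})$, $Y=L^2(0,T;L^2)$, $W=\{\Psi\in X:\Psi'\in X^*\}$. Data: $\alpha\in\{0,1\}$; real $V_0,V_u\in L^\infty(\Omega)$; a real control $u\in H^1(0,T)$; $F\in Y$; $\Psi_0\in L^2$; $\Lambda\in X$; real functions $V_x,V_c$ on $[0,\infty)$ that are weakly differentiable (locally absolutely continuous on $[0,\infty)$, with fixed Borel representatives $V_x',V_c'$ of their derivatives). For $\psi:\Omega\to\mathbb C^N$ put $\rho_\psi=\sum_j|\psi_j|^2$, $V_H(r)(x)=\int_\Omega \frac{r(y)}{|x-y|}dy$, $V(\psi)=V_H(\rho_\psi)+V_x(\rho_\psi)+V_c(\rho_\psi)$, and, at time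 $t$, $V_{ext}=V_0+V_u\,u(t)$, $\Lambda=\Lambda(t)$, $$B(\Psi,\Phi;u(t))=(\nabla\Psi,\nabla\Phi)+(V_{ext}\Psi,\Phi)+(1-\alpha)(V(\Lambda)\Psi,\Phi)+(1-\alpha)D(\Psi,\Phi),$$ $$D(\Psi,\Phi)=\bigl(V_H(2\,\mathrm{Re}\,(\Psi,\Lambda)_{\mathbb C})\Lambda,\Phi\bigr)+\bigl(2(V_x'+V_c')(\rho_\Lambda)\,\mathrm{Re}\,(\Psi,\Lambda)_{\mathbb C}\,\Lambda,\Phi\bigr),\qquad (\Psi,\Lambda)_{\mathbb C}=\sum_j\Psi_j\overline{\Lambda_j}.$$ A weak solution is a $\Psi\in W$ such that for a.e. $t\in(0,T)$ one has $\alpha V(\Psi(t))\Psi(t)\in L^2$ and $$i\langle\Psi'(t),\Phi\rangle=B(\Psi(t),\Phi;u(t))+\alpha\,(V(\Psi(t))\Psi(t),\Phi)+(F(t),\Phi)\qquad\text{for all }\Phi\in H^1_0,$$ and whose continuous representative $[0,T]\to L^2$ satisfies $\Psi(0)=\Psi_0$. Assume: (a) $V_c$ is bounded on $[0,\infty)$.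 (b) If $\alpha=1$: $\rho\mapsto\rho V_c'(\rho)$ is bounded on $[0,\infty)$, and there is $L\ge0$ such that for any two weak solutions $\Psi,\Upsilon$ and a.e. $t\in(0,T)$, $\|V_x(\rho_{\Psi(t)})\Psi(t)-V_x(\rho_{\Upsilon(t)})\Upsilon(t)\|_{L^2}\le L\|\Psi(t)-\Upsilon(t)\|_{L^2}$. (c) If $\alpha=0$: $\Lambda\in L^2(0,T;H^2(\Omega;\mathbb C^N))$, and there is $M$ with $|\rho\,(V_x'+V_c')(\rho)|\le M(1+\rho)$ for all $\rho\ge0$. Theorem. There is at most one weak solution: if $\Psi,\Upsilon\in W$ are weak solutions, then $\Psi=\Upsilon$. -/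

import Mathlib

open MeasureTheory Set
open scoped ENNReal NNReal ContDiff

noncomputable section

namespace TDKS

/-- Physical space `ℝ³`. -/
abbrev E3 : Type := EuclideanSpace ℝ (Fin 3)

/-- The value space `ℂᴺ` with its Euclidean norm. -/
abbrev CN (N : ℕ) : Type := EuclideanSpace ℂ (Fin N)

/-- Lebesgue measure on `Ω`. -/
abbrev muO (Ω : Set E3) : Measure E3 := volume.restrict Ω

/-- Lebesgue measure on the time interval `(0,T)`. -/
abbrev muT (T : ℝ) : Measure ℝ := volume.restrict (Ioo 0 T)

/-- `L²(Ω; ℂᴺ)`. -/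
abbrev L2 (N : ℕ) (Ω : Set E3) : Type := Lp (CN N) 2 (muO Ω)

/-- `φ` belongs to `C_c^∞(U)`: smooth, with compact support contained in the set `U`. -/
def IsTest {E F : Type*} [NormedAddCommGroup E] [NormedSpace ℝ E]
    [NormedAddCommGroup F] [NormedSpace ℝ F] (U : Set E) (φ : E → F) : Prop :=
  ContDiff ℝ ∞ φ ∧ HasCompactSupport φ ∧ tsupport φ ⊆ U

/-- The classical partial derivative `∂_i φ`. -/
def pd {F : Type*} [NormedAddCommGroup F] [NormedSpace ℝ F] (i : Fin 3) (φ : E3 → F)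
    (x : E3) : F :=
  fderiv ℝ φ x (EuclideanSpace.single i 1)

/-- The Hilbert space `L² × (L²)³` of pairs `(f, (g_1, g_2, g_3))`, with the norm
`(‖f‖² + ‖g_1‖² + ‖g_2‖² + ‖g_3‖²)^{1/2}`. -/
abbrev PairSpace (N : ℕ) (Ω : Set E3) : Type :=
  WithLp 2 (L2 N Ω × PiLp 2 (fun _ : Fin 3 => L2 N Ω))

/-- `H¹₀(Ω; ℂᴺ)`: the closure of `{(φ, ∇φ) : φ ∈ C_c^∞(Ω; ℂᴺ)}` in the `H¹` norm. An element is
a function together with its gradient; the norm is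
`‖Ψ‖²_{H¹} = ‖Ψ‖²_{L²} + ‖∇Ψ‖²_{L²}`. -/
def H10sub (N : ℕ) (Ω : Set E3) : Submodule ℂ (PairSpace N Ω) :=
  (Submodule.span ℂ {w : PairSpace N Ω | ∃ φ : E3 → CN N, IsTest Ω φ ∧
    (w.fst : E3 → CN N) =ᵐ[muO Ω] φ ∧
    ∀ i, (w.snd i : E3 → CN N) =ᵐ[muO Ω] pd i φ}).topologicalClosure

/-- `H¹₀(Ω; ℂᴺ)` as a Hilbert space. -/
abbrev H10 (N : ℕ) (Ω : Set E3) : Type := H10sub N Ω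

/-- The function underlying an element of `H¹₀`, as an element of `L²`. -/
def H10.val {N : ℕ} {Ω : Set E3} (w : H10 N Ω) : L2 N Ω := (w : PairSpace N Ω).fst

/-- The partial derivative `∂_i` of an element of `H¹₀`, as an element of `L²`. -/
def H10.grad {N : ℕ} {Ω : Set E3} (w : H10 N Ω) (i : Fin 3) : L2 N Ω :=
  (w : PairSpace N Ω).snd i

/-- `H⁻¹(Ω; ℂᴺ)`: the bounded antilinear functionals on `H¹₀`. With this choice
`f ∈ L²` is the functional `Φ ↦ (f, Φ)`, the scalar product being antilinear in `Φ`. -/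
abbrev Hm1 (N : ℕ) (Ω : Set E3) : Type := H10 N Ω →L⋆[ℂ] ℂ

/-- `Y = L²(0,T; L²(Ω; ℂᴺ))`. -/
abbrev Y (N : ℕ) (Ω : Set E3) (T : ℝ) : Type := Lp (L2 N Ω) 2 (muT T)

/-- `X = L²(0,T; H¹₀(Ω; ℂᴺ))`. -/
abbrev X (N : ℕ) (Ω : Set E3) (T : ℝ) : Type := Lp (H10 N Ω) 2 (muT T)

/-- `X* = L²(0,T; H⁻¹(Ω; ℂᴺ))`. -/
abbrev Xstar (N : ℕ) (Ω : Set E3) (T : ℝ) : Type := Lp (Hm1 N Ω) 2 (muT T)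

/-- The scalar product `(f, g) = ∫_Ω ∑_j f_j(x) conj(g_j(x)) dx`, linear in `f` and antilinear
in `g`. (`inner ℂ` is antilinear in its first argument.) -/
def sp {N : ℕ} (Ω : Set E3) (f g : E3 → CN N) : ℂ := ∫ x in Ω, inner ℂ (g x) (f x)

/-- `Ψ' ∈ X*` is the weak time derivative of `Ψ ∈ X`. -/
def IsTimeDeriv {N : ℕ} {Ω : Set E3} {T : ℝ} (Ψ : X N Ω T) (Ψ' : Xstar N Ω T) : Prop :=
  ∀ (η : ℝ → ℝ), IsTest (Ioo 0 T) η → ∀ Φ : H10 N Ω,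
    ∫ t in Ioo 0 T, ((deriv η t : ℝ) : ℂ) * sp Ω (Ψ t).val Φ.val
      = - ∫ t in Ioo 0 T, (η t : ℂ) * Ψ' t Φ

/-- `Ψ(0) = Ψ₀`: the continuous representative `[0,T] → L²` of `Ψ` takes the value `Ψ₀` at `0`. -/
def HasInitialValue {N : ℕ} {Ω : Set E3} {T : ℝ} (Ψ : X N Ω T) (Ψ₀ : L2 N Ω) : Prop :=
  ∃ c : ℝ → L2 N Ω, ContinuousOn c (Icc 0 T) ∧ (∀ᵐ t ∂(muT T), c t = (Ψ t).val) ∧ c 0 = Ψ₀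

/-- `u ∈ H¹(0,T)`, real-valued. -/
def MemH1Time (T : ℝ) (u : ℝ → ℝ) : Prop :=
  MemLp u 2 (muT T) ∧ ∃ u' : ℝ → ℝ, MemLp u' 2 (muT T) ∧
    ∀ η : ℝ → ℝ, IsTest (Ioo 0 T) η →
      ∫ t in Ioo 0 T, u t * deriv η t = - ∫ t in Ioo 0 T, u' t * η t

/-- `g` is the weak partial derivative `∂_i f` in `Ω`. -/
def IsWeakPartial {N : ℕ} (Ω : Set E3) (i : Fin 3) (f g : E3 → CN N) : Prop :=
  ∀ φ : E3 → ℝ, IsTest Ω φ → ∫ x in Ω, pd i φ x • f x = - ∫ x in Ω, φ x • g x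

/-- `Λ ∈ X` lies in `L²(0,T; H²(Ω; ℂᴺ))`: all second weak derivatives `∂_j ∂_i Λ` lie in
`L²(0,T; L²(Ω; ℂᴺ))`. (The derivatives of order at most one do, as `Λ ∈ X`.) -/
def MemL2H2 {N : ℕ} {Ω : Set E3} {T : ℝ} (Λ : X N Ω T) : Prop :=
  ∃ h : Fin 3 → Fin 3 → Y N Ω T, ∀ᵐ t ∂(muT T), ∀ i j,
    IsWeakPartial Ω j ((Λ t).grad i) (h i j t)

/-- `V`, as a function of `ρ ∈ [0,∞)`, is weakly differentiable with (Borel) weak derivative `g`: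
`g` is integrable on every `[0,ρ]` and `V(ρ) = V(0) + ∫₀^ρ g`. -/
def IsWeakDerivDensity (V g : ℝ → ℝ) : Prop :=
  Measurable g ∧ ∀ ρ : ℝ, 0 ≤ ρ →
    IntervalIntegrable g volume 0 ρ ∧ V ρ = V 0 + ∫ s in (0 : ℝ)..ρ, g s

/-- The density `ρ(x) = ∑_j |ψ_j(x)|²`. -/
def density {N : ℕ} (ψ : E3 → CN N) (x : E3) : ℝ := ∑ j, ‖ψ x j‖ ^ 2

/-- `Re (ψ(x), λ(x))_ℂ`, with `(ψ, λ)_ℂ = ∑_j ψ_j conj(λ_j)`. -/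
def reProd {N : ℕ} (ψ lam : E3 → CN N) (x : E3) : ℝ := (inner ℂ (lam x) (ψ x)).re

/-- The Hartree potential `∫_Ω r(y) / |x - y| dy` of a scalar function `r`. -/
def hartree (Ω : Set E3) (r : E3 → ℝ) (x : E3) : ℝ := ∫ y in Ω, r y / ‖x - y‖

/-- The data of the unified problem: the parameter `α`, the external potential
`V₀(x) + V_u(x) u(t)`, the exchange and correlation potentials as functions of the density with
representatives `dVx`, `dVc` of their derivatives, the forward state `Λ` (it enters only with the
factor `1 - α`), the inhomogeneity `F` and the initial value `Ψ₀`. -/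
structure Data (N : ℕ) (Ω : Set E3) (T : ℝ) where
  α : ℝ
  V0 : E3 → ℝ
  Vu : E3 → ℝ
  u : ℝ → ℝ
  Vx : ℝ → ℝ
  Vc : ℝ → ℝ
  dVx : ℝ → ℝ
  dVc : ℝ → ℝ
  Λ : X N Ω T
  F : Y N Ω T
  Ψ₀ : L2 N Ω

variable {N : ℕ} {Ω : Set E3} {T : ℝ}

/-- The Kohn-Sham potential `V(ψ) = V_H(ρ) + V_x(ρ) + V_c(ρ)`, `ρ` the density of `ψ`. -/
def Data.V (P : Data N Ω T) (ψ : E3 → CN N) (x : E3) : ℝ :=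
  hartree Ω (density ψ) x + P.Vx (density ψ x) + P.Vc (density ψ x)

/-- The external potential `V_ext(x,t;u) = V₀(x) + V_u(x) u(t)`. -/
def Data.Vext (P : Data N Ω T) (t : ℝ) (x : E3) : ℝ := P.V0 x + P.Vu x * P.u t

/-- `D_H(ψ,φ) = (V_H(2 Re(ψ,Λ)) Λ, φ)` at time `t`. -/
def Data.DH (P : Data N Ω T) (t : ℝ) (ψ φ : E3 → CN N) : ℂ :=
  sp Ω (fun x => hartree Ω (fun y => 2 * reProd ψ (P.Λ t).val y) x • (P.Λ t).val x) φ

/-- `D_xc(ψ,φ) = (2 (∂V_xc/∂ρ)(Λ) Re(ψ,Λ) Λ, φ)` at time `t`. -/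
def Data.Dxc (P : Data N Ω T) (t : ℝ) (ψ φ : E3 → CN N) : ℂ :=
  sp Ω (fun x =>
    (2 * (P.dVx (density (P.Λ t).val x) + P.dVc (density (P.Λ t).val x))
      * reProd ψ (P.Λ t).val x) • (P.Λ t).val x) φ

/-- `D = D_H + D_xc`. -/
def Data.D (P : Data N Ω T) (t : ℝ) (ψ φ : E3 → CN N) : ℂ := P.DH t ψ φ + P.Dxc t ψ φ

/-- `B(Ψ,Φ;u) = (∇Ψ,∇Φ) + (V_ext Ψ,Φ) + (1-α)(V(Λ)Ψ,Φ) + (1-α) D(Ψ,Φ)` at time `t`. -/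
def Data.B (P : Data N Ω T) (t : ℝ) (Ψ Φ : H10 N Ω) : ℂ :=
  (∑ i, sp Ω (Ψ.grad i) (Φ.grad i))
    + sp Ω (fun x => P.Vext t x • Ψ.val x) Φ.val
    + (1 - P.α : ℂ) * sp Ω (fun x => P.V (P.Λ t).val x • Ψ.val x) Φ.val
    + (1 - P.α : ℂ) * P.D t Ψ.val Φ.val

/-- `Ψ` is a weak solution: `Ψ ∈ X` with `Ψ' ∈ X*`, for almost every `t` the term
`α V(Ψ(t))Ψ(t)` lies in `L²(Ω; ℂᴺ)` and
`i ⟨Ψ'(t),Φ⟩ = B(Ψ(t),Φ;u(t)) + α (V(Ψ(t))Ψ(t),Φ) + (F(t),Φ)` for all `Φ ∈ H¹₀`,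
and `Ψ(0) = Ψ₀`. -/
def Data.IsWeakSolution (P : Data N Ω T) (Ψ : X N Ω T) : Prop :=
  (∃ Ψ' : Xstar N Ω T, IsTimeDeriv Ψ Ψ' ∧
    ∀ᵐ t ∂(muT T),
      MemLp (fun x => (P.α * P.V (Ψ t).val x) • (Ψ t).val x) 2 (muO Ω) ∧
      ∀ Φ : H10 N Ω,
        Complex.I * Ψ' t Φ
          = P.B t (Ψ t) Φ
            + (P.α : ℂ) * sp Ω (fun x => P.V (Ψ t).val x • (Ψ t).val x) Φ.val
            + sp Ω (P.F t) Φ.val) ∧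
  HasInitialValue Ψ P.Ψ₀

end TDKS

end

/-!
Let `Ψ`, `Υ` be two weak solutions and `Φ = Ψ - Υ`. Then `i Φ' + ΔΦ = g`, where `g` collects the
differences of the terms of order zero, and `Φ(0) = 0`. The proof has two halves: an `L²` estimate
`‖g(t)‖ ≤ k(t) ‖Φ(t)‖` with `k ∈ L¹(0,T)`, and the fact that such a `Φ` vanishes
(`Data.eq_of_isWeakSolution`).

*Uniqueness from the estimate* (`eq_zero_of_schrodinger`). Formally one tests with `Φ`, takes the
imaginary part and applies Gronwall's inequality to `‖Φ‖²`. To avoid the theory of the Gelfand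
triple `H¹₀ ⊂ L² ⊂ H⁻¹`, let `ι : H¹₀ → L²` be the embedding and test with `K ι* ι Φ`, where
`K = (ι* ι + ε)⁻¹` is bounded on `H¹₀`. As `K ι* ι = 1 - ε K` is self-adjoint on `H¹₀`, the pairing
with the principal part is real and drops out; `ι* ι Φ` is the primitive of the Riesz representative
of `Φ'`, so that the energy identity is Fubini's theorem (`re_inner_primitive_eq`). In the limit
`ε → 0` the energy `⟨K ι* ι Φ, ι* ι Φ⟩` becomes `‖Φ‖²` in `L²`.

*The Lipschitz estimate.* Hardy's inequality `∫ |w|² / |x - y|² dy ≤ 4 ‖w‖²` in `H¹₀` (`hardy`)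
bounds the Hartree potential of a product `|f| |w|` by `2 ‖f‖ ‖w‖` uniformly in `x`
(`coulomb_bound`). The map `z ↦ V_c(|z|²) z` is Lipschitz when `V_c` and `ρ V_c'(ρ)` are bounded,
because `V_c` is then Lipschitz in `log ρ` (`IsWeakDerivDensity.norm_smul_sub_smul_le`). Together with
the hypothesis on `V_x` this settles the forward equation, with `k` quadratic in the `H¹` norms of
the solutions.

The adjoint equation is linear; apart from the Hartree terms, which are treated as above, its
coefficients are bounded by a multiple of `1 + |u(t)| + |Λ(t,x)|²`. So it suffices that
`t ↦ ‖Λ(t)‖²_{L^∞}` is integrable, which follows from `Λ ∈ L²(0,T; H²)` and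
`‖u‖²_{L^∞} ≤ 12 ‖u‖²_{H¹} + ∑ᵢ ‖∂ᵢ² u‖²` for `u ∈ H¹₀` (`ae_norm_sq_le`). No regularity of the boundary
of `Ω` is available, so the usual Sobolev embedding is replaced by the following argument: testing
`-Δu` with `φ u`, for `φ` the regularised Newtonian kernel centred at `x`, bounds
`∫ (-Δφ) |u|²` and hence the averages of `|u|²` over balls around `x`; Lebesgue's differentiation
theorem gives the pointwise bound. Multiplication by a smooth weight maps `H¹₀` to itself, so no
boundary terms appear (`H10.integral_weight_eq`).
-/

namespace TDKS

open Filter Topology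

/-! ### Primitives of Bochner integrable functions -/

section Primitive

variable {E F G : Type*} [NormedAddCommGroup E] [NormedSpace ℝ E]
  [NormedAddCommGroup F] [NormedSpace ℝ F] [NormedAddCommGroup G] [NormedSpace ℝ G]
  {μ : Measure ℝ}

theorem integral_Iio_eq_add_intervalIntegral [NullSingletonClass μ] {a : ℝ → E}
    (ha : Integrable a μ) (t : ℝ) :
    ∫ s in Iio t, a s ∂μ = (∫ s in Iic (0 : ℝ), a s ∂μ) + ∫ s in (0 : ℝ)..t, a s ∂μ := by
  rw [← integral_Iic_eq_integral_Iio,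
    ← intervalIntegral.integral_Iic_sub_Iic ha.integrableOn ha.integrableOn]
  abel

theorem continuous_integral_Iio [NullSingletonClass μ] {a : ℝ → E} (ha : Integrable a μ) :
    Continuous fun t => ∫ s in Iio t, a s ∂μ := by
  simp_rw [integral_Iio_eq_add_intervalIntegral ha]
  exact continuous_const.add
    (intervalIntegral.continuous_primitive (fun _ _ => ha.intervalIntegrable) 0)

/-- Integration by parts for two Bochner primitives, as Fubini's theorem on the two halves
`s < t` and `t ≤ s` of the square. -/
theorem integral_bilin_primitive [CompleteSpace E] [CompleteSpace F] [CompleteSpace G]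
    [SFinite μ] [NullSingletonClass μ] {a : ℝ → E} {b : ℝ → F} (L : E →L[ℝ] F →L[ℝ] G)
    (ha : Integrable a μ) (hb : Integrable b μ) :
    (∫ t, L (∫ s in Iio t, a s ∂μ) (b t) ∂μ) + ∫ t, L (a t) (∫ s in Iio t, b s ∂μ) ∂μ
      = L (∫ t, a t ∂μ) (∫ t, b t ∂μ) := by
  have hf : Integrable (fun z : ℝ × ℝ => L (a z.1) (b z.2)) (μ.prod μ) :=
    ha.op_fst_snd (op := fun x y => L x y) (by fun_prop) ⟨‖L‖, L.le_opNorm₂⟩ hb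
  have hS : MeasurableSet {z : ℝ × ℝ | z.1 < z.2} := measurableSet_lt measurable_fst measurable_snd
  have hf1 := hf.indicator hS
  have hf2 := hf.indicator hS.compl
  have e : (∫ z, L (a z.1) (b z.2) ∂μ.prod μ) = L (∫ t, a t ∂μ) (∫ t, b t ∂μ) :=
    integral_prod_bilin L ha hb
  rw [← e, ← integral_add_compl hS hf, ← integral_indicator hS,
    ← integral_indicator hS.compl, integral_prod_symm _ hf1, integral_prod _ hf2]
  congr 1
  · refine integral_congr_ae (ae_of_all _ fun t => ?_)
    dsimp only
    rw [← ContinuousLinearMap.flip_apply, ← ContinuousLinearMap.integral_comp_comm _ ha.integrableOn,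
      ← integral_indicator measurableSet_Iio]
    refine integral_congr_ae (ae_of_all _ fun s => ?_)
    by_cases hst : s < t <;> simp [indicator, hst]
  · refine integral_congr_ae (ae_of_all _ fun s => ?_)
    dsimp only
    rw [← integral_Iic_eq_integral_Iio, ← ContinuousLinearMap.integral_comp_comm _ hb.integrableOn,
      ← integral_indicator measurableSet_Iic]
    refine integral_congr_ae (ae_of_all _ fun t => ?_)
    by_cases hst : t ≤ s <;> simp [indicator, hst]

end Primitive

/-! ### Functions with an integrable weak derivative -/

theorem IsTest.integrable {g : ℝ → ℝ} {U : Set ℝ} (hg : IsTest U g) : Integrable g :=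
  hg.1.continuous.integrable_of_hasCompactSupport hg.2.1

theorem hasDerivAt_integral_Iio {g : ℝ → ℝ} (hg : Continuous g) (hgi : Integrable g) (x : ℝ) :
    HasDerivAt (fun x => ∫ t in Iio x, g t) (g x) x := by
  simp_rw [integral_Iio_eq_add_intervalIntegral hgi]
  exact (intervalIntegral.integral_hasDerivAt_right hgi.intervalIntegrable
    (hg.stronglyMeasurableAtFilter _ _) hg.continuousAt).const_add _

/-- A test function on `(0,T)` of mean zero is the derivative of its primitive, which is again a
test function on `(0,T)`. -/
theorem isTest_integral_Iio {T : ℝ} {g : ℝ → ℝ} (hg : IsTest (Ioo 0 T) g) (h0 : ∫ t, g t = 0) :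
    IsTest (Ioo 0 T) (fun x => ∫ t in Iio x, g t) := by
  obtain ⟨hs, hc, hsub⟩ := hg
  have hgi : Integrable g := hs.continuous.integrable_of_hasCompactSupport hc
  have hd := hasDerivAt_integral_Iio hs.continuous hgi
  have hder : deriv (fun x => ∫ t in Iio x, g t) = g := funext fun x => (hd x).deriv
  obtain ⟨a, b, ha, hb, hab⟩ : ∃ a b, 0 < a ∧ b < T ∧ tsupport g ⊆ Icc a b := by
    rcases (tsupport g).eq_empty_or_nonempty with h | h
    · exact ⟨1, T - 1, one_pos, by linarith, by simp [h]⟩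
    · exact ⟨sInf (tsupport g), sSup (tsupport g), (hsub (hc.isCompact.sInf_mem h)).1,
        (hsub (hc.isCompact.sSup_mem h)).2, fun x hx =>
          ⟨csInf_le hc.isCompact.bddBelow hx, le_csSup hc.isCompact.bddAbove hx⟩⟩
  have hz : ∀ x, x ∉ Icc a b → g x = 0 := fun x hx =>
    image_eq_zero_of_notMem_tsupport fun h => hx (hab h)
  have hts : tsupport (fun x => ∫ t in Iio x, g t) ⊆ Icc a b := by
    refine closure_minimal (fun x hx => ?_) isClosed_Icc
    by_contra hxab
    refine hx ?_
    rcases lt_or_ge x a with h | h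
    · exact setIntegral_eq_zero_of_forall_eq_zero fun t ht =>
        hz t fun h' => absurd (h'.1.trans_lt ht) h.not_gt
    · have hbx : b < x := lt_of_not_ge fun h' => hxab ⟨h, h'⟩
      rw [← h0]
      exact setIntegral_eq_integral_of_forall_compl_eq_zero fun t ht =>
        hz t fun h' => absurd (h'.2.trans_lt hbx) (by simpa using ht)
  refine ⟨?_, HasCompactSupport.of_support_subset_isCompact isCompact_Icc
    ((subset_tsupport _).trans hts), hts.trans fun x hx => ⟨ha.trans_le hx.1, hx.2.trans_lt hb⟩⟩
  rw [contDiff_infty_iff_deriv, hder]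
  exact ⟨fun x => (hd x).differentiableAt, hs⟩

theorem exists_isTest_integral_eq_one {T : ℝ} (hT : 0 < T) :
    ∃ χ : ℝ → ℝ, IsTest (Ioo 0 T) χ ∧ ∫ t, χ t = 1 := by
  let f : ContDiffBump (T / 2) := ⟨T / 8, T / 4, by positivity, by linarith⟩
  refine ⟨f.normed volume, ⟨f.contDiff_normed, f.hasCompactSupport_normed, ?_⟩, f.integral_normed⟩
  rw [f.tsupport_normed_eq]
  intro x hx
  rw [Metric.mem_closedBall, Real.dist_eq, abs_le] at hx
  have : f.rOut = T / 4 := rfl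
  constructor <;> linarith [hx.1, hx.2]

theorem IsTest.add {E F : Type*} [NormedAddCommGroup E] [NormedSpace ℝ E]
    [NormedAddCommGroup F] [NormedSpace ℝ F] {U : Set E} {f g : E → F}
    (hf : IsTest U f) (hg : IsTest U g) : IsTest U (fun x => f x + g x) :=
  ⟨hf.1.add hg.1, hf.2.1.add hg.2.1, (tsupport_add f g).trans (union_subset hf.2.2 hg.2.2)⟩

theorem IsTest.const_smul {E F R : Type*} [NormedAddCommGroup E] [NormedSpace ℝ E]
    [NormedAddCommGroup F] [NormedSpace ℝ F] [NormedField R] [NormedSpace R F] [SMulCommClass ℝ R F]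
    {U : Set E} {f : E → F}
    (c : R) (hf : IsTest U f) : IsTest U (fun x => c • f x) :=
  ⟨hf.1.const_smul c, hf.2.1.smul_left (f := fun _ => c),
    (tsupport_smul_subset_right (fun _ => c) f).trans hf.2.2⟩

theorem eqOn_Icc_of_ae_eq {E : Type*} [TopologicalSpace E] [T2Space E] {T : ℝ} (hT : 0 < T)
    {f g : ℝ → E} (h : f =ᵐ[muT T] g) (hf : ContinuousOn f (Icc 0 T))
    (hg : ContinuousOn g (Icc 0 T)) : EqOn f g (Icc 0 T) := by
  refine Measure.eqOn_of_ae_eq (μ := volume) ?_ hf hg ?_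
  · rwa [← restrict_Ioo_eq_restrict_Icc]
  · rw [interior_Icc, closure_Ioo hT.ne]

theorem integral_Iio_zero {E : Type*} [NormedAddCommGroup E] [NormedSpace ℝ E] {T : ℝ}
    (p : ℝ → E) : ∫ s in Iio 0, p s ∂(muT T) = 0 := by
  rw [Measure.restrict_restrict measurableSet_Iio,
    show Iio 0 ∩ Ioo 0 T = ∅ from eq_empty_of_forall_notMem fun x hx => lt_asymm hx.1 hx.2.1]
  simp

section WeakDerivative

variable {E : Type*} [NormedAddCommGroup E] [NormedSpace ℝ E] [CompleteSpace E] {T : ℝ}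

/-- The **du Bois-Reymond lemma**: a function with vanishing weak derivative is constant. -/
theorem ae_eq_const_of_weakDeriv_eq_zero (hT : 0 < T) {y : ℝ → E} (hy : Integrable y (muT T))
    (h : ∀ η : ℝ → ℝ, IsTest (Ioo 0 T) η → ∫ t in Ioo 0 T, deriv η t • y t = 0) :
    ∃ e : E, ∀ᵐ t ∂(muT T), y t = e := by
  obtain ⟨χ, hχ, hχ1⟩ := exists_isTest_integral_eq_one hT
  have hint : ∀ g : ℝ → ℝ, IsTest (Ioo 0 T) g → Integrable (fun t => g t • y t) (muT T) := by
    intro g hg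
    obtain ⟨C, hC⟩ := hg.2.1.exists_bound_of_continuous hg.1.continuous
    exact hy.bdd_smul C hg.1.continuous.aestronglyMeasurable (ae_of_all _ hC)
  refine ⟨∫ t in Ioo 0 T, χ t • y t, ?_⟩
  set e := ∫ t in Ioo 0 T, χ t • y t with he
  have key := isOpen_Ioo.ae_eq_zero_of_integral_contDiff_smul_eq_zero (U := Ioo 0 T)
    (μ := muT T) (f := fun t => y t - e)
    ((hy.sub (integrable_const e)).locallyIntegrable.locallyIntegrableOn _) ?_
  · filter_upwards [key, ae_restrict_mem measurableSet_Ioo] with t ht ht'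
    exact sub_eq_zero.1 (ht ht')
  intro g hg1 hg2 hg3
  have hg : IsTest (Ioo 0 T) g := ⟨hg1, hg2, hg3⟩
  -- `g - (∫ g) χ` has mean zero, so it is the derivative of a test function
  have hgm : IsTest (Ioo 0 T) (fun t => g t + (-∫ s, g s) • χ t) := hg.add (hχ.const_smul _)
  have h0 : ∫ t, (g t + (-∫ s, g s) • χ t) = 0 := by
    rw [integral_add hg.integrable (hχ.integrable.const_mul _ : Integrable fun t => (-∫ s, g s) • χ t),
      integral_smul, hχ1]
    simp
  have := h _ (isTest_integral_Iio hgm h0)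
  have hder : deriv (fun x => ∫ t in Iio x, (g t + (-∫ s, g s) • χ t))
      = fun t => g t + (-∫ s, g s) • χ t :=
    funext fun x => (hasDerivAt_integral_Iio hgm.1.continuous hgm.integrable x).deriv
  rw [hder] at this
  have hgI : ∫ t in Ioo 0 T, g t = ∫ t, g t :=
    setIntegral_eq_integral_of_forall_compl_eq_zero fun t ht =>
      image_eq_zero_of_notMem_tsupport fun h => ht (hg3 h)
  simp_rw [add_smul, smul_assoc] at this
  rw [integral_add (hint g hg) ((hint χ hχ).fun_smul _), integral_smul, ← he] at this
  simp_rw [smul_sub]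
  rw [integral_sub (hint g hg) (hg.integrable.integrableOn.smul_const e), integral_smul_const, hgI,
    ← this]
  module

/-- A continuous function with integrable weak derivative `p` is the primitive of `p`. -/
theorem ae_eq_add_integral_Iio (hT : 0 < T) {f p : ℝ → E} (hf : ContinuousOn f (Icc 0 T))
    (hp : Integrable p (muT T))
    (h : ∀ η : ℝ → ℝ, IsTest (Ioo 0 T) η →
      ∫ t in Ioo 0 T, deriv η t • f t = - ∫ t in Ioo 0 T, η t • p t) :
    ∀ᵐ t ∂(muT T), f t = f 0 + ∫ s in Iio t, p s ∂(muT T) := by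
  set P : ℝ → E := fun t => ∫ s in Iio t, p s ∂(muT T) with hP
  have hPc : Continuous P := continuous_integral_Iio hp
  have hfi : Integrable f (muT T) :=
    (hf.integrableOn_compact isCompact_Icc).mono_set Ioo_subset_Icc_self
  have hPi : Integrable P (muT T) :=
    (hPc.continuousOn.integrableOn_compact isCompact_Icc).mono_set Ioo_subset_Icc_self
  -- the primitive `P` has the weak derivative `p` as well, so `f - P` is constant
  obtain ⟨e, he⟩ := ae_eq_const_of_weakDeriv_eq_zero hT (hfi.sub hPi) (by
    intro η hη
    have hη' : Continuous (deriv η) := hη.1.continuous_deriv (by simp)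
    have hηc : HasCompactSupport (deriv η) := hη.2.1.deriv
    obtain ⟨C, hC⟩ := hηc.exists_bound_of_continuous hη'
    have hη'i : Integrable (deriv η) (muT T) :=
      (hη'.integrable_of_hasCompactSupport hηc).integrableOn
    have hη'z : ∀ t, t ∉ Ioo 0 T → deriv η t = 0 := fun t ht =>
      image_eq_zero_of_notMem_tsupport fun h' => ht (hη.2.2 (tsupport_deriv_subset h'))
    have hFTC : ∀ t, ∫ s in Iio t, deriv η s ∂(muT T) = η t := by
      intro t
      rw [← integral_Iic_eq_integral_Iio, Measure.restrict_restrict measurableSet_Iic]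
      rw [← setIntegral_eq_of_subset_of_forall_sdiff_eq_zero (measurableSet_Iic (a := t))
        inter_subset_left (fun s hs => hη'z s fun h' => hs.2 ⟨hs.1, h'⟩)]
      exact hη.2.1.integral_Iic_deriv_eq (hη.1.of_le (by simp)) t
    have hz : ∫ t in Ioo 0 T, deriv η t = 0 := by
      rw [setIntegral_eq_integral_of_forall_compl_eq_zero fun t ht => hη'z t ht]
      exact integral_eq_zero_of_hasDerivAt_of_integrable
        (fun t => (hη.1.differentiable (by simp) t).hasDerivAt)
        (hη'.integrable_of_hasCompactSupport hηc) hη.integrable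
    have hparts := integral_bilin_primitive (μ := muT T) (ContinuousLinearMap.lsmul ℝ ℝ (E := E))
      hη'i hp
    simp only [ContinuousLinearMap.lsmul_apply, hFTC, hz, zero_smul] at hparts
    have h1 : Integrable (fun t => deriv η t • f t) (muT T) :=
      hfi.bdd_smul C hη'.aestronglyMeasurable (ae_of_all _ hC)
    have h2 : Integrable (fun t => deriv η t • P t) (muT T) :=
      hPi.bdd_smul C hη'.aestronglyMeasurable (ae_of_all _ hC)
    simp only [Pi.sub_apply, smul_sub]
    rw [integral_sub h1 h2, h η hη]
    rw [add_comm] at hparts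
    rw [eq_neg_of_add_eq_zero_left hparts, sub_self])
  have hfP : ContinuousOn (fun t => f t - P t) (Icc 0 T) := hf.sub hPc.continuousOn
  have hall : ∀ t ∈ Icc 0 T, f t - P t = e := by
    refine eqOn_Icc_of_ae_eq hT ?_ hfP continuousOn_const
    filter_upwards [he] with t ht using ht
  have hP0 : P 0 = 0 := integral_Iio_zero p
  filter_upwards [ae_restrict_mem measurableSet_Ioo] with t ht
  have h0 := hall 0 ⟨le_rfl, hT.le⟩
  have h1 := hall t (Ioo_subset_Icc_self ht)
  rw [hP0, sub_zero] at h0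
  rw [h0, ← h1]
  abel

end WeakDerivative

/-! ### Gronwall's inequality with an integrable kernel -/

/-- **Gronwall's inequality** with an integrable kernel and zero initial value. The set where the
primitive `G` of `k y` vanishes is closed, and it is open to the right: if `G x = 0`, then
`G r ≤ (∫_x^r k) G r`, where `∫_x^r k ≤ 1/2` for `r` close to `x`. -/
theorem eq_zero_of_le_integral_Iio {T : ℝ} (hT : 0 < T) {y k : ℝ → ℝ}
    (hy : ContinuousOn y (Icc 0 T)) (hy0 : ∀ t ∈ Icc 0 T, 0 ≤ y t) (hk : Integrable k (muT T))
    (hk0 : ∀ᵐ t ∂(muT T), 0 ≤ k t)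
    (h : ∀ᵐ t ∂(muT T), y t ≤ ∫ s in Iio t, k s * y s ∂(muT T)) :
    ∀ t ∈ Icc 0 T, y t = 0 := by
  have hyI : ContinuousOn y (Icc 0 T) → AEStronglyMeasurable y (muT T) := fun h =>
    (h.mono Ioo_subset_Icc_self).aestronglyMeasurable measurableSet_Ioo
  obtain ⟨C, hC⟩ := isCompact_Icc.exists_bound_of_continuousOn hy
  have hky : Integrable (fun t => k t * y t) (muT T) := by
    refine hk.mul_bdd (c := C) (hyI hy) ?_
    filter_upwards [ae_restrict_mem measurableSet_Ioo] with t ht using hC t (Ioo_subset_Icc_self ht)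
  have hky0 : ∀ᵐ t ∂(muT T), 0 ≤ k t * y t := by
    filter_upwards [hk0, ae_restrict_mem measurableSet_Ioo] with t h1 h2
    exact mul_nonneg h1 (hy0 t (Ioo_subset_Icc_self h2))
  set G : ℝ → ℝ := fun t => ∫ s in Iio t, k s * y s ∂(muT T) with hG
  have hGc : Continuous G := continuous_integral_Iio hky
  have hGm : Monotone G := fun a b hab =>
    setIntegral_mono_set hky.integrableOn (ae_restrict_of_ae hky0)
      (Iio_subset_Iio hab).eventuallyLE
  have hyG : ∀ t ∈ Icc 0 T, y t ≤ G t := by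
    have := eqOn_Icc_of_ae_eq hT (f := fun t => max (y t - G t) 0) (g := fun _ => 0) (by
      filter_upwards [h] with t ht
      exact max_eq_right (sub_nonpos.2 ht))
      ((hy.sub hGc.continuousOn).sup continuousOn_const) continuousOn_const
    intro t ht
    exact sub_nonpos.1 (max_eq_right_iff.1 (this ht))
  have hsub : Icc 0 T ⊆ {t | G t ≤ 0} := by
    refine IsClosed.Icc_subset_of_forall_exists_gt
      ((isClosed_le hGc continuous_const).inter isClosed_Icc)
      (show G 0 ≤ 0 from (integral_Iio_zero _).le) ?_
    rintro x ⟨hx, hx0, hxT⟩ z hz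
    have hKc := continuous_integral_Iio hk
    have hev : ∀ᶠ r in 𝓝[>] x, (∫ s in Iio r, k s ∂(muT T)) < (∫ s in Iio x, k s ∂(muT T)) + 1 / 2 :=
      (hKc.continuousAt.eventually (gt_mem_nhds (by linarith))).filter_mono nhdsWithin_le_nhds
    obtain ⟨r, hr, hrmem⟩ := (hev.and (Ioc_mem_nhdsGT (lt_min hz hxT))).exists
    have hxr : x < r := hrmem.1
    have hrz : r ≤ z := hrmem.2.trans (min_le_left _ _)
    have hrT : r ≤ T := hrmem.2.trans (min_le_right _ _)
    refine ⟨r, ?_, hxr, hrz⟩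
    have hsplit : ∀ f : ℝ → ℝ, Integrable f (muT T) →
        ∫ s in Iio r, f s ∂(muT T) = ∫ s in Iio x, f s ∂(muT T) + ∫ s in Ico x r, f s ∂(muT T) := by
      intro f hf
      rw [← Iio_union_Ico_eq_Iio hxr.le]
      exact setIntegral_union (disjoint_left.2 fun a ha hb => absurd hb.1 (not_le.2 ha))
        measurableSet_Ico hf.integrableOn hf.integrableOn
    have h1 := hsplit _ hky
    have h2 := hsplit _ hk
    have h3 : ∫ s in Ico x r, k s * y s ∂(muT T) ≤ ∫ s in Ico x r, k s * G r ∂(muT T) := by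
      refine integral_mono_ae hky.integrableOn (hk.integrableOn.mul_const _) ?_
      filter_upwards [ae_restrict_of_ae hk0, ae_restrict_of_ae (ae_restrict_mem measurableSet_Ioo),
        ae_restrict_mem measurableSet_Ico] with s hs1 hs2 hs3
      exact mul_le_mul_of_nonneg_left
        ((hyG s (Ioo_subset_Icc_self hs2)).trans (hGm hs3.2.le)) hs1
    rw [integral_mul_const] at h3
    have hr0 : 0 ≤ G r := (hy0 r ⟨hx0.trans hxr.le, hrT⟩).trans (hyG r ⟨hx0.trans hxr.le, hrT⟩)
    have h4 : G r ≤ G x + (∫ s in Ico x r, k s ∂(muT T)) * G r := by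
      rw [hG] at h3 ⊢; dsimp only at h3 ⊢; rw [h1] at h3 ⊢; linarith
    have h5 : ∫ s in Ico x r, k s ∂(muT T) ≤ 1 / 2 := by linarith
    have h6 : G x ≤ 0 := hx
    change G r ≤ 0
    nlinarith
  intro t ht
  exact le_antisymm ((hyG t ht).trans (hsub ht)) (hy0 t ht)

/-! ### Energy estimate for abstract Schrödinger equations -/

section Energy

variable {V H : Type*} [NormedAddCommGroup V] [InnerProductSpace ℂ V] [CompleteSpace V]
  [NormedAddCommGroup H] [InnerProductSpace ℂ H] [CompleteSpace H]

open ContinuousLinearMap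

local notation "⟪" x ", " y "⟫" => inner ℂ x y

theorem re_inner_self {E : Type*} [NormedAddCommGroup E] [InnerProductSpace ℂ E] (x : E) :
    (⟪x, x⟫).re = ‖x‖ ^ 2 :=
  inner_self_eq_norm_sq (𝕜 := ℂ) x

/-- The operator `K = (ι* ι + ε)⁻¹` on `V`, which is self-adjoint; `K ι* ι = 1 - ε K` approximates the
identity as `ε → 0`. -/
theorem exists_resolvent (ι : V →L[ℂ] H) {ε : ℝ} (hε : 0 < ε) :
    ∃ K : V →L[ℂ] V, (∀ v w, ⟪K v, w⟫ = ⟪v, K w⟫) ∧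
      (∀ v, adjoint ι (ι (K v)) + (ε : ℂ) • K v = v) ∧
      ∀ v, K (adjoint ι (ι v)) = v - (ε : ℂ) • K v := by
  set A : V →L[ℂ] V := adjoint ι ∘L ι + (ε : ℂ) • ContinuousLinearMap.id ℂ V with hA
  have hAv : ∀ v, A v = adjoint ι (ι v) + (ε : ℂ) • v := fun v => rfl
  have hAs : ∀ v w, ⟪A v, w⟫ = ⟪v, A w⟫ := fun v w => by
    simp [hAv, adjoint_inner_left, adjoint_inner_right]
  have hu : IsUnit A := by
    refine isUnit_of_forall_le_norm_inner_map A (c := ⟨ε, hε.le⟩) hε fun x => ?_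
    refine le_trans ?_ (Complex.re_le_norm _)
    rw [hAv, inner_add_left, adjoint_inner_left, inner_smul_left, Complex.add_re, Complex.conj_ofReal,
      Complex.re_ofReal_mul, re_inner_self, re_inner_self]
    change ‖x‖ ^ 2 * ε ≤ _
    nlinarith [sq_nonneg ‖ι x‖]
  obtain ⟨u, hu⟩ := hu
  have h1 : ∀ v, A ((↑u⁻¹ : V →L[ℂ] V) v) = v := fun v => by
    rw [← hu]; exact DFunLike.congr_fun u.mul_inv v
  have h2 : ∀ v, (↑u⁻¹ : V →L[ℂ] V) (A v) = v := fun v => by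
    rw [← hu]; exact DFunLike.congr_fun u.inv_mul v
  refine ⟨↑u⁻¹, fun v w => ?_, fun v => h1 v, fun v => ?_⟩
  · conv_lhs => rw [← h1 w]
    rw [← hAs, h1]
  · rw [eq_sub_iff_add_eq, ← map_smul, ← map_add]
    exact h2 v

/-- For `x = K v`, where `K = (ι* ι + ε)⁻¹`: the error `ε K v` of the regularisation is of order `√ε`
in `H`. -/
theorem norm_resolvent_le (ι : V →L[ℂ] H) {ε : ℝ} (hε : 0 < ε) {x v : V}
    (h : adjoint ι (ι x) + (ε : ℂ) • x = v) : ‖ι ((ε : ℂ) • x)‖ ^ 2 ≤ ε * ‖v‖ ^ 2 := by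
  have h1 : ‖ι x‖ ^ 2 + ε * ‖x‖ ^ 2 ≤ ‖x‖ * ‖v‖ := by
    have := congrArg Complex.re (congrArg (fun z => ⟪x, z⟫) h)
    simp only [inner_add_right, adjoint_inner_right, inner_smul_right, Complex.add_re,
      Complex.re_ofReal_mul, re_inner_self] at this
    rw [this]
    exact re_inner_le_norm (𝕜 := ℂ) x v
  have h2 : ε * ‖x‖ ≤ ‖v‖ := by
    rcases (norm_nonneg x).eq_or_lt with h0 | h0
    · rw [← h0, mul_zero]; positivity
    · refine le_of_mul_le_mul_left ?_ h0
      nlinarith [sq_nonneg ‖ι x‖]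
  rw [map_smul, norm_smul, Complex.norm_real, Real.norm_of_nonneg hε.le, mul_pow]
  calc ε ^ 2 * ‖ι x‖ ^ 2 ≤ ε ^ 2 * (‖x‖ * ‖v‖) := by
        gcongr; nlinarith [sq_nonneg ‖x‖]
    _ = ε * ((ε * ‖x‖) * ‖v‖) := by ring
    _ ≤ ε * (‖v‖ * ‖v‖) := by gcongr
    _ = ε * ‖v‖ ^ 2 := by ring

/-- For `x = K ι* ι v`, where `K = (ι* ι + ε)⁻¹`: the regularisation does not increase the norm of
`H`. -/
theorem norm_resolvent_adjoint_le (ι : V →L[ℂ] H) {ε : ℝ} (hε : 0 < ε) {x v : V}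
    (h : adjoint ι (ι x) + (ε : ℂ) • x = adjoint ι (ι v)) : ‖ι x‖ ≤ ‖ι v‖ := by
  have h1 : ‖ι x‖ ^ 2 + ε * ‖x‖ ^ 2 ≤ ‖ι x‖ * ‖ι v‖ := by
    have := congrArg Complex.re (congrArg (fun z => ⟪x, z⟫) h)
    simp only [inner_add_right, adjoint_inner_right, inner_smul_right, Complex.add_re,
      Complex.re_ofReal_mul, re_inner_self] at this
    rw [this]
    exact re_inner_le_norm (𝕜 := ℂ) (ι x) (ι v)
  rcases (norm_nonneg (ι x)).eq_or_lt with h0 | h0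
  · rw [← h0]; positivity
  · refine le_of_mul_le_mul_left ?_ h0
    nlinarith [sq_nonneg ‖x‖]

variable {T : ℝ}

theorem integrable_re_inner_primitive {E : Type*} [NormedAddCommGroup E] [InnerProductSpace ℂ E]
    (K : E →L[ℂ] E) {p : ℝ → E} (hp : Integrable p (muT T)) :
    Integrable (fun s => (⟪K (∫ r in Iio s, p r ∂(muT T)), p s⟫).re) (muT T) := by
  have hm : AEStronglyMeasurable (fun s => K (∫ r in Iio s, p r ∂(muT T))) (muT T) :=
    (K.continuous.comp (continuous_integral_Iio hp)).aestronglyMeasurable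
  refine (hp.norm.const_mul (‖K‖ * ∫ r, ‖p r‖ ∂(muT T))).mono'
    (Complex.continuous_re.comp_aestronglyMeasurable (hm.inner hp.1)) (ae_of_all _ fun s => ?_)
  refine (Complex.abs_re_le_norm _).trans ((norm_inner_le_norm _ _).trans ?_)
  gcongr
  refine (K.le_opNorm _).trans ?_
  gcongr
  exact (norm_integral_le_integral_norm _).trans
    (setIntegral_le_integral hp.norm (ae_of_all _ fun _ => norm_nonneg _))

/-- The identity `d/dt ⟨P, K P⟩ = 2 Re ⟨K P, p⟩` for a primitive `P` of `p`, in integrated form. -/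
theorem re_inner_primitive_eq {K : V →L[ℂ] V} (hK : ∀ v w, ⟪K v, w⟫ = ⟪v, K w⟫) {p : ℝ → V}
    (hp : Integrable p (muT T)) (t : ℝ) :
    (⟪K (∫ s in Iio t, p s ∂(muT T)), ∫ s in Iio t, p s ∂(muT T)⟫).re
      = 2 * ∫ s in Iio t, (⟪K (∫ r in Iio s, p r ∂(muT T)), p s⟫).re ∂(muT T) := by
  let : InnerProductSpace ℝ V := InnerProductSpace.complexToReal
  let L : V →L[ℝ] V →L[ℝ] ℝ := (innerSL ℝ (E := V)).comp (K.restrictScalars ℝ)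
  have hL : ∀ v w, L v w = (⟪K v, w⟫).re := fun v w => real_inner_eq_re_inner ℂ (K v) w
  have h := integral_bilin_primitive (μ := (muT T).restrict (Iio t)) L hp.integrableOn hp.integrableOn
  simp only [hL] at h
  rw [← h, two_mul]
  have e : ∀ s ∈ Iio t, ∫ r in Iio s, p r ∂((muT T).restrict (Iio t))
      = ∫ r in Iio s, p r ∂(muT T) := fun s hs => by
    rw [Measure.restrict_restrict measurableSet_Iio,
      inter_eq_left.2 (Iio_subset_Iio (le_of_lt hs))]
  congr 1
  · exact setIntegral_congr_fun measurableSet_Iio fun s hs => by rw [e s hs]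
  · refine setIntegral_congr_fun measurableSet_Iio fun s hs => ?_
    rw [e s hs, hK, ← inner_conj_symm, Complex.conj_re]

/-- **Uniqueness for abstract Schrödinger equations.** Let `φ` solve `i φ' = A φ + g` weakly, where
`⟨w, A φ⟩ = ⟨w, φ⟩_V` and the remainder satisfies `|⟨w, g⟩| ≤ k ‖φ‖_H ‖w‖_H` with an integrable `k`.
If `φ` starts at `0`, it vanishes. The weak derivative `φ'` is represented by `p` through the scalar
product of `V`, and `c` is the continuous representative of `φ` in `H`.

The equation is tested with the regularisation `K ι* ι φ`, `K = (ι* ι + ε)⁻¹`: since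
`⟨K ι* ι φ, φ⟩_V` is real, the main part drops out of the energy identity. -/
theorem eq_zero_of_schrodinger (hT : 0 < T) (ι : V →L[ℂ] H) {φ p : ℝ → V} {c : ℝ → H} {k : ℝ → ℝ}
    (hc : ContinuousOn c (Icc 0 T)) (hc0 : c 0 = 0) (hcφ : ∀ᵐ t ∂(muT T), c t = ι (φ t))
    (hp : Integrable p (muT T))
    (hder : ∀ η : ℝ → ℝ, IsTest (Ioo 0 T) η → ∀ w : V,
      ∫ t in Ioo 0 T, ((deriv η t : ℝ) : ℂ) * ⟪ι w, c t⟫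
        = - ∫ t in Ioo 0 T, (η t : ℂ) * ⟪w, p t⟫)
    (hk : Integrable k (muT T)) (hk0 : ∀ᵐ t ∂(muT T), 0 ≤ k t)
    (heq : ∀ᵐ t ∂(muT T), ∀ w : V,
      ‖Complex.I * ⟪w, p t⟫ - ⟪w, φ t⟫‖ ≤ k t * ‖ι (φ t)‖ * ‖ι w‖) :
    ∀ t ∈ Icc 0 T, c t = 0 := by
  have hfc : ContinuousOn (fun t => adjoint ι (c t)) (Icc 0 T) :=
    (adjoint ι).continuous.comp_continuousOn hc
  have hprim : ∀ᵐ t ∂(muT T), adjoint ι (c t) = ∫ s in Iio t, p s ∂(muT T) := by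
    have := ae_eq_add_integral_Iio hT hfc hp ?_
    · simpa [hc0] using this
    intro η hη
    have hb : ∀ ξ : ℝ → ℝ, Continuous ξ → HasCompactSupport ξ → ∀ f : ℝ → V,
        Integrable f (muT T) → Integrable (fun t => ξ t • f t) (muT T) := fun ξ h1 h2 f hf => by
      obtain ⟨C, hC⟩ := h2.exists_bound_of_continuous h1
      exact Integrable.bdd_smul (𝕜 := ℝ) hf C h1.aestronglyMeasurable (ae_of_all _ hC)
    have hi1 := hb _ (hη.1.continuous_deriv (by simp)) hη.2.1.deriv _
      ((hfc.integrableOn_compact isCompact_Icc).mono_set Ioo_subset_Icc_self)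
    have hi2 := hb _ hη.1.continuous hη.2.1 _ hp
    refine ext_inner_left ℂ fun w => ?_
    rw [inner_neg_right, ← integral_inner hi1, ← integral_inner hi2]
    simp only [inner_smul_right_eq_smul, adjoint_inner_right, Complex.real_smul]
    exact hder η hη w
  have hcI : ∀ᵐ t ∂(muT T), t ∈ Ioo 0 T := ae_restrict_mem measurableSet_Ioo
  obtain ⟨C, hC⟩ := isCompact_Icc.exists_bound_of_continuousOn hc
  have hkc : Integrable (fun t => k t * ‖c t‖ ^ 2) (muT T) := by
    refine hk.mul_bdd (c := C ^ 2)
      (((hc.norm.pow 2).mono Ioo_subset_Icc_self).aestronglyMeasurable measurableSet_Ioo) ?_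
    filter_upwards [hcI] with t ht
    rw [Real.norm_of_nonneg (by positivity)]
    exact pow_le_pow_left₀ (norm_nonneg _) (hC t (Ioo_subset_Icc_self ht)) 2
  have hmain : ∀ᵐ t ∂(muT T), ‖c t‖ ^ 2 ≤ ∫ s in Iio t, (2 * k s) * ‖c s‖ ^ 2 ∂(muT T) := by
    filter_upwards [hprim, hcφ] with t ht1 ht2
    have hε : ∀ ε : ℝ, 0 < ε → ‖c t‖ ^ 2 - √ε * (‖c t‖ * ‖φ t‖)
        ≤ ∫ s in Iio t, (2 * k s) * ‖c s‖ ^ 2 ∂(muT T) := by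
      intro ε hε
      obtain ⟨K, hK1, hK2, hK3⟩ := exists_resolvent ι hε
      have hE := re_inner_primitive_eq hK1 hp t
      rw [← ht1] at hE
      -- the regularised energy is close to `‖c t‖ ^ 2`
      have hlow : ‖c t‖ ^ 2 - √ε * (‖c t‖ * ‖φ t‖)
          ≤ (⟪K (adjoint ι (c t)), adjoint ι (c t)⟫).re := by
        rw [adjoint_inner_right, ht2, hK3, map_sub, inner_sub_left, Complex.sub_re,
          re_inner_self]
        have h1 := norm_resolvent_le ι hε (hK2 (φ t))
        have h2 : ‖ι ((ε : ℂ) • K (φ t))‖ ≤ √ε * ‖φ t‖ := by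
          refine le_of_sq_le_sq ?_ (by positivity)
          rwa [mul_pow, Real.sq_sqrt hε.le]
        have h3 := re_inner_le_norm (𝕜 := ℂ) (ι ((ε : ℂ) • K (φ t))) (ι (φ t))
        have h4 := mul_le_mul_of_nonneg_right h2 (norm_nonneg (ι (φ t)))
        simp only [RCLike.re_to_complex] at h3
        nlinarith
      -- its time derivative, by the equation tested with `w = K ι* ι φ`
      have hup : ∫ s in Iio t, (⟪K (∫ r in Iio s, p r ∂(muT T)), p s⟫).re ∂(muT T)
          ≤ ∫ s in Iio t, k s * ‖c s‖ ^ 2 ∂(muT T) := by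
        refine integral_mono_ae (integrable_re_inner_primitive K hp).integrableOn hkc.integrableOn ?_
        filter_upwards [ae_restrict_of_ae hprim, ae_restrict_of_ae hcφ, ae_restrict_of_ae heq,
          ae_restrict_of_ae hk0] with s hs1 hs2 hs3 hs4
        rw [← hs1, hs2]
        set w := K (adjoint ι (ι (φ s))) with hw
        have hw1 : ‖ι w‖ ≤ ‖ι (φ s)‖ := norm_resolvent_adjoint_le ι hε (hK2 _)
        have hreal : (⟪w, φ s⟫).im = 0 := by
          rw [hw, hK3, inner_sub_left, inner_smul_left, Complex.sub_im, Complex.conj_ofReal,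
            Complex.im_ofReal_mul]
          have : (⟪K (φ s), φ s⟫).im = 0 := by
            rw [← Complex.conj_eq_iff_im, inner_conj_symm, hK1]
          rw [this, mul_zero, sub_zero]
          exact inner_self_im (𝕜 := ℂ) (φ s)
        have h1 := (Complex.abs_im_le_norm _).trans (hs3 w)
        rw [Complex.sub_im, hreal, sub_zero, Complex.I_mul_im] at h1
        refine (le_abs_self _).trans (h1.trans ?_)
        rw [sq, ← mul_assoc]
        gcongr
      calc _ ≤ _ := hlow
        _ = _ := hE
        _ ≤ 2 * ∫ s in Iio t, k s * ‖c s‖ ^ 2 ∂(muT T) := by gcongr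
        _ = _ := by rw [← integral_const_mul]; simp only [mul_assoc]
    have hlim : Tendsto (fun ε : ℝ => ‖c t‖ ^ 2 - √ε * (‖c t‖ * ‖φ t‖)) (𝓝[>] 0)
        (𝓝 (‖c t‖ ^ 2)) := by
      have : Continuous (fun ε : ℝ => ‖c t‖ ^ 2 - √ε * (‖c t‖ * ‖φ t‖)) := by fun_prop
      have h := this.tendsto 0
      simp only [Real.sqrt_zero, zero_mul, sub_zero] at h
      exact h.mono_left nhdsWithin_le_nhds
    exact le_of_tendsto hlim (eventually_mem_nhdsWithin.mono fun ε hε' => hε ε hε')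
  intro t ht
  have := eq_zero_of_le_integral_Iio hT (y := fun t => ‖c t‖ ^ 2) (k := fun t => 2 * k t)
    (hc.norm.pow 2) (fun _ _ => by positivity) (hk.const_mul 2)
    (hk0.mono fun t ht => by positivity) hmain t ht
  simpa using this

end Energy

variable {N : ℕ} {Ω : Set E3} {T : ℝ}

/-! ### The Hilbert space `H¹₀` -/

theorem isClosed_H10sub : IsClosed (H10sub N Ω : Set (PairSpace N Ω)) :=
  Submodule.isClosed_topologicalClosure _

instance : CompleteSpace (H10 N Ω) := isClosed_H10sub.completeSpace_coe

/-- The embedding `H¹₀ → L²`, as a bounded operator. -/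
noncomputable def H10.valL : H10 N Ω →L[ℂ] L2 N Ω :=
  (WithLp.fstL 2 ℂ (L2 N Ω) (PiLp 2 fun _ : Fin 3 => L2 N Ω)).comp (H10sub N Ω).subtypeL

/-- The partial derivative `∂_i : H¹₀ → L²`, as a bounded operator. -/
noncomputable def H10.gradL (i : Fin 3) : H10 N Ω →L[ℂ] L2 N Ω :=
  (PiLp.proj 2 (fun _ : Fin 3 => L2 N Ω) i).comp
    ((WithLp.sndL 2 ℂ (L2 N Ω) (PiLp 2 fun _ : Fin 3 => L2 N Ω)).comp (H10sub N Ω).subtypeL)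

theorem H10.continuous_val : Continuous (H10.val : H10 N Ω → L2 N Ω) := H10.valL.continuous

theorem H10.continuous_grad (i : Fin 3) : Continuous fun w : H10 N Ω => w.grad i :=
  (H10.gradL i).continuous

theorem H10.val_sub (v w : H10 N Ω) : (v - w).val = v.val - w.val := rfl

theorem H10.grad_sub (v w : H10 N Ω) (i : Fin 3) : (v - w).grad i = v.grad i - w.grad i := rfl

theorem H10.inner_eq (v w : H10 N Ω) :
    inner ℂ v w = inner ℂ v.val w.val + ∑ i, inner ℂ (v.grad i) (w.grad i) := rfl

theorem H10.norm_sq_eq (w : H10 N Ω) : ‖w‖ ^ 2 = ‖w.val‖ ^ 2 + ∑ i, ‖w.grad i‖ ^ 2 := by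
  have := congrArg Complex.re (H10.inner_eq w w)
  simpa only [Complex.add_re, Complex.re_sum, re_inner_self] using this

theorem H10.sum_norm_grad_sq_le (w : H10 N Ω) : ∑ i, ‖w.grad i‖ ^ 2 ≤ ‖w‖ ^ 2 := by
  rw [w.norm_sq_eq]; nlinarith [sq_nonneg ‖w.val‖]

theorem H10.norm_val_le (w : H10 N Ω) : ‖w.val‖ ≤ ‖w‖ := by
  refine le_of_sq_le_sq ?_ (norm_nonneg _)
  rw [w.norm_sq_eq]
  have : 0 ≤ ∑ i, ‖w.grad i‖ ^ 2 := Finset.sum_nonneg fun _ _ => sq_nonneg _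
  linarith

theorem sp_eq_inner (f g : L2 N Ω) : sp Ω f g = inner ℂ g f := rfl

theorem integrable_inner_of_memLp {α E : Type*} [MeasurableSpace α] {μ : Measure α}
    [NormedAddCommGroup E] [InnerProductSpace ℂ E] {f g : α → E} (hf : MemLp f 2 μ)
    (hg : MemLp g 2 μ) : Integrable (fun x => inner ℂ (f x) (g x)) μ := by
  refine (L2.integrable_inner (𝕜 := ℂ) hf.toLp hg.toLp).congr ?_
  filter_upwards [hf.coeFn_toLp, hg.coeFn_toLp] with x h1 h2
  rw [h1, h2]

theorem integral_inner_eq_inner_toLp {ξ : E3 → CN N} (hξ : MemLp ξ 2 (muO Ω)) (f : L2 N Ω) :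
    ∫ x in Ω, inner ℂ (ξ x) (f x) = inner ℂ hξ.toLp f := by
  rw [L2.inner_def]
  refine integral_congr_ae ?_
  filter_upwards [hξ.coeFn_toLp] with x hx
  rw [hx]

theorem IsTest.memLp {E F : Type*} [NormedAddCommGroup E] [NormedSpace ℝ E]
    [NormedAddCommGroup F] [NormedSpace ℝ F] [MeasurableSpace E] [BorelSpace E]
    [SecondCountableTopologyEither E F] {U : Set E} {χ : E → F}
    (hχ : IsTest U χ) (p : ℝ≥0∞) (μ : Measure E) [IsFiniteMeasureOnCompacts μ] : MemLp χ p μ :=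
  hχ.1.continuous.memLp_of_hasCompactSupport hχ.2.1

theorem IsTest.pd {F : Type*} [NormedAddCommGroup F] [NormedSpace ℝ F] {χ : E3 → F}
    (hχ : IsTest Ω χ) (i : Fin 3) : IsTest Ω (pd i χ) := by
  refine ⟨(hχ.1.fderiv_right (by simp)).clm_apply contDiff_const, hχ.2.1.fderiv_apply ℝ _, ?_⟩
  exact (tsupport_fderiv_apply_subset ℝ _).trans hχ.2.2

theorem setIntegral_eq_integral_of_isTest {F G : Type*} [NormedAddCommGroup F] [NormedSpace ℝ F]
    [NormedAddCommGroup G] [NormedSpace ℝ G] {χ : E3 → F} (hχ : IsTest Ω χ) {f : E3 → G}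
    (hf : ∀ x, χ x = 0 → f x = 0) : ∫ x in Ω, f x = ∫ x, f x :=
  setIntegral_eq_integral_of_forall_compl_eq_zero fun x hx =>
    hf x (image_eq_zero_of_notMem_tsupport fun h => hx (hχ.2.2 h))

theorem pd_add {F : Type*} [NormedAddCommGroup F] [NormedSpace ℝ F] {f g : E3 → F} (i : Fin 3)
    (hf : Differentiable ℝ f) (hg : Differentiable ℝ g) (x : E3) :
    pd i (fun x => f x + g x) x = pd i f x + pd i g x := by
  simp only [TDKS.pd]; rw [fderiv_fun_add (hf x) (hg x)]; rfl

theorem pd_smul {F : Type*} [NormedAddCommGroup F] [NormedSpace ℝ F] {φ : E3 → ℝ} {f : E3 → F}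
    (i : Fin 3) (hφ : Differentiable ℝ φ) (hf : Differentiable ℝ f) (x : E3) :
    pd i (fun x => φ x • f x) x = φ x • pd i f x + pd i φ x • f x := by
  simp only [TDKS.pd]; rw [fderiv_fun_smul (hφ x) (hf x)]; rfl

/-- The element `w` of `H¹₀` is given by the test function `χ` and its classical derivatives. -/
def IsTestElement (w : H10 N Ω) (χ : E3 → CN N) : Prop :=
  IsTest Ω χ ∧ (w.val : E3 → CN N) =ᵐ[muO Ω] χ ∧ ∀ i, (w.grad i : E3 → CN N) =ᵐ[muO Ω] pd i χ

/-- A closed property of elements of `H¹₀` holds if it holds for test functions: these already form a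
linear subspace, so they are dense in the closure that defines `H¹₀`. -/
theorem H10.induction {p : H10 N Ω → Prop} (hp : IsClosed {w | p w})
    (h : ∀ w χ, IsTestElement w χ → p w) (w : H10 N Ω) : p w := by
  set S : Set (PairSpace N Ω) := {w : PairSpace N Ω | ∃ φ : E3 → CN N, IsTest Ω φ ∧
    (w.fst : E3 → CN N) =ᵐ[muO Ω] φ ∧ ∀ i, (w.snd i : E3 → CN N) =ᵐ[muO Ω] pd i φ} with hS
  let S' : Submodule ℂ (PairSpace N Ω) :=
    { carrier := S
      add_mem' := by
        rintro a b ⟨φ, h1, h2, h3⟩ ⟨ψ, h4, h5, h6⟩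
        refine ⟨fun x => φ x + ψ x, h1.add h4, ?_, fun i => ?_⟩
        · filter_upwards [Lp.coeFn_add a.fst b.fst, h2, h5] with x e1 e2 e3
          rw [WithLp.add_fst, e1, Pi.add_apply, e2, e3]
        · filter_upwards [Lp.coeFn_add (a.snd i) (b.snd i), h3 i, h6 i] with x e1 e2 e3
          rw [WithLp.add_snd, PiLp.add_apply, e1, Pi.add_apply, e2, e3,
            pd_add i (h1.1.differentiable (by simp)) (h4.1.differentiable (by simp))]
      zero_mem' := by
        refine ⟨fun _ => 0, ⟨contDiff_const, HasCompactSupport.zero, by simp [tsupport]⟩, ?_,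
          fun i => ?_⟩
        · filter_upwards [Lp.coeFn_zero (CN N) 2 (muO Ω)] with x e1
          exact e1
        · filter_upwards [Lp.coeFn_zero (CN N) 2 (muO Ω)] with x e1
          refine Eq.trans e1 ?_
          simp [TDKS.pd]
      smul_mem' := by
        rintro c a ⟨φ, h1, h2, h3⟩
        refine ⟨fun x => c • φ x, h1.const_smul c, ?_, fun i => ?_⟩
        · filter_upwards [Lp.coeFn_smul c a.fst, h2] with x e1 e2
          rw [WithLp.smul_fst, e1, Pi.smul_apply, e2]
        · filter_upwards [Lp.coeFn_smul c (a.snd i), h3 i] with x e1 e2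
          rw [WithLp.smul_snd, PiLp.smul_apply, e1, Pi.smul_apply, e2]
          simp only [TDKS.pd]
          rw [fderiv_fun_const_smul (h1.1.differentiable (by simp) x)]
          rfl }
  have hspan : (Submodule.span ℂ S : Set (PairSpace N Ω)) ⊆ Subtype.val '' {w : H10 N Ω | p w} := by
    intro v hv
    obtain ⟨φ, hφ⟩ : v ∈ S' := (Submodule.span_le (p := S')).2 (fun x hx => hx) hv
    exact ⟨⟨v, subset_closure hv⟩, h _ φ hφ, rfl⟩
  have hcl : IsClosed (Subtype.val '' {w : H10 N Ω | p w}) :=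
    isClosed_H10sub.isClosedEmbedding_subtypeVal.isClosedMap _ hp
  obtain ⟨w', hw', e⟩ := closure_minimal hspan hcl w.2
  rwa [← Subtype.ext e]

/-- Multiplication by an essentially bounded real function as an operator on `L²`. -/
noncomputable def mulL {m : E3 → ℝ} (hm : MemLp (fun x => (m x : ℂ)) ∞ (muO Ω)) :
    L2 N Ω →L[ℂ] L2 N Ω :=
  (ContinuousLinearMap.lsmul ℂ ℂ (E := CN N)).holderL (muO Ω) ∞ 2 2 hm.toLp

theorem mulL_coe {m : E3 → ℝ} (hm : MemLp (fun x => (m x : ℂ)) ∞ (muO Ω)) (f : L2 N Ω) :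
    mulL hm f =ᵐ[muO Ω] fun x => m x • f x := by
  filter_upwards [ContinuousLinearMap.coeFn_holder (r := 2)
    (ContinuousLinearMap.lsmul ℂ ℂ (E := CN N)) hm.toLp f, hm.coeFn_toLp] with x h1 h2
  refine h1.trans ?_
  rw [h2, ContinuousLinearMap.lsmul_apply, Complex.coe_smul]

theorem memLp_top_of_continuous (hΩ : Bornology.IsBounded Ω) (hΩm : MeasurableSet Ω) {m : E3 → ℝ}
    (hm : Continuous m) : MemLp (fun x => (m x : ℂ)) ∞ (muO Ω) := by
  obtain ⟨C, hC⟩ := hΩ.isCompact_closure.exists_bound_of_continuousOn hm.continuousOn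
  refine memLp_top_of_bound (Complex.continuous_ofReal.comp hm).aestronglyMeasurable C ?_
  filter_upwards [ae_restrict_mem hΩm] with x hx
  rw [Complex.norm_real]
  exact hC x (subset_closure hx)

/-! ### Weak derivatives -/

/-- `h` is the weak partial derivative `∂_i g` in `Ω`, tested with `ℂᴺ`-valued test functions. -/
def HasWeakPartial (Ω : Set E3) (i : Fin 3) (g h : E3 → CN N) : Prop :=
  ∀ χ : E3 → CN N, IsTest Ω χ →
    ∫ x in Ω, inner ℂ (pd i χ x) (g x) = - ∫ x in Ω, inner ℂ (χ x) (h x)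

/-- Real-valued test functions suffice: a `ℂᴺ`-valued test function is a sum of real-valued ones times
the vectors `e_k` and `i e_k`. -/
theorem IsWeakPartial.hasWeakPartial {i : Fin 3} {g h : L2 N Ω} (H : IsWeakPartial Ω i g h) :
    HasWeakPartial Ω i g h := by
  have hint : ∀ (χ : E3 → CN N) (f : L2 N Ω), IsTest Ω χ →
      Integrable (fun x => inner ℂ (χ x) (f x)) (muO Ω) := fun χ f hχ =>
    integrable_inner_of_memLp (hχ.memLp 2 _) (Lp.memLp f)
  have hadd : ∀ χ₁ χ₂ : E3 → CN N, IsTest Ω χ₁ → IsTest Ω χ₂ →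
      (∫ x in Ω, inner ℂ (pd i χ₁ x) (g x) = - ∫ x in Ω, inner ℂ (χ₁ x) (h x)) →
      (∫ x in Ω, inner ℂ (pd i χ₂ x) (g x) = - ∫ x in Ω, inner ℂ (χ₂ x) (h x)) →
      ∫ x in Ω, inner ℂ (pd i (fun x => χ₁ x + χ₂ x) x) (g x)
        = - ∫ x in Ω, inner ℂ (χ₁ x + χ₂ x) (h x) := by
    intro χ₁ χ₂ h1 h2 e1 e2
    simp only [pd_add i (h1.1.differentiable (by simp)) (h2.1.differentiable (by simp)),
      inner_add_left]
    rw [integral_add (hint _ _ (h1.pd i)) (hint _ _ (h2.pd i)), integral_add (hint _ _ h1)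
      (hint _ _ h2), e1, e2]
    ring
  have hbase : ∀ (φ : E3 → ℝ) (e : CN N), IsTest Ω φ → IsTest Ω (fun x => φ x • e) ∧
      ∫ x in Ω, inner ℂ (pd i (fun x => φ x • e) x) (g x)
        = - ∫ x in Ω, inner ℂ (φ x • e) (h x) := by
    intro φ e hφ
    refine ⟨⟨hφ.1.smul contDiff_const, hφ.2.1.smul_right (f' := fun _ => e),
      (tsupport_smul_subset_left φ fun _ => e).trans hφ.2.2⟩, ?_⟩
    have hs : ∀ (ξ : E3 → ℝ) (f : L2 N Ω), IsTest Ω ξ →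
        ∫ x in Ω, inner ℂ (ξ x • e) (f x) = inner ℂ e (∫ x in Ω, ξ x • f x) := by
      intro ξ f hξ
      have hi : Integrable (fun x => ξ x • f x) (muO Ω) :=
        memLp_one_iff_integrable.1 ((Lp.memLp f).smul (hξ.memLp 2 _))
      rw [← integral_inner hi]
      refine integral_congr_ae (ae_of_all _ fun x => ?_)
      simp [inner_smul_right_eq_smul, inner_smul_left_eq_smul]
    have hp : ∀ x, pd i (fun x => φ x • e) x = pd i φ x • e := fun x => by
      rw [pd_smul i (hφ.1.differentiable (by simp)) (differentiable_const e)]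
      simp [TDKS.pd]
    simp only [hp]
    rw [hs _ g (hφ.pd i), hs _ h hφ, H φ hφ, inner_neg_right]
  intro χ hχ
  have hcomp : ∀ (L : CN N →L[ℝ] ℝ), IsTest Ω (fun x => L (χ x)) := fun L =>
    ⟨L.contDiff.comp hχ.1, hχ.2.1.comp_left (map_zero L),
      (tsupport_comp_subset (map_zero L) χ).trans hχ.2.2⟩
  have hsum : ∀ s : Finset (Fin N), IsTest Ω (fun x => ∑ k ∈ s, EuclideanSpace.single k (χ x k)) ∧
      ∫ x in Ω, inner ℂ (pd i (fun x => ∑ k ∈ s, EuclideanSpace.single k (χ x k)) x) (g x)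
        = - ∫ x in Ω, inner ℂ (∑ k ∈ s, EuclideanSpace.single k (χ x k)) (h x) := by
    intro s
    induction s using Finset.induction_on with
    | empty =>
      have := hbase (fun _ => 0) 0 ⟨contDiff_const, HasCompactSupport.zero, by simp [tsupport]⟩
      simpa using this
    | insert k s hk ih =>
      let pk : CN N →L[ℝ] ℂ := (EuclideanSpace.proj k : CN N →L[ℂ] ℂ).restrictScalars ℝ
      have h1 := hbase _ (EuclideanSpace.single k 1) (hcomp (Complex.reCLM.comp pk))
      have h2 := hbase _ (EuclideanSpace.single k Complex.I) (hcomp (Complex.imCLM.comp pk))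
      have h3 := hadd _ _ h1.1 h2.1 h1.2 h2.2
      have h4 := hadd _ _ (h1.1.add h2.1) ih.1 h3 ih.2
      have h5 := (h1.1.add h2.1).add ih.1
      have e : ∀ x, EuclideanSpace.single k (χ x k)
          = (Complex.reCLM.comp pk) (χ x) • (EuclideanSpace.single k (1 : ℂ) : CN N)
            + (Complex.imCLM.comp pk) (χ x) • (EuclideanSpace.single k Complex.I : CN N) := by
        intro x
        ext j
        by_cases hj : j = k
        · subst hj
          simp [pk, Complex.re_add_im]
        · simp [hj]
      simp only [Finset.sum_insert hk, e]
      exact ⟨h5, h4⟩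
  have := (hsum Finset.univ).2
  have e : ∀ x, ∑ k, EuclideanSpace.single k (χ x k) = χ x := fun x => by
    ext j; simp
  simpa only [e] using this

theorem hasWeakPartial_of_isTest {χ : E3 → CN N} (hχ : IsTest Ω χ) (i : Fin 3) :
    HasWeakPartial Ω i χ (pd i χ) := by
  intro ψ hψ
  rw [setIntegral_eq_integral_of_isTest (hψ.pd i) (fun x hx => by rw [hx, inner_zero_left]),
    setIntegral_eq_integral_of_isTest hψ (fun x hx => by rw [hx, inner_zero_left])]
  have hB := (isBoundedBilinearMap_inner (𝕜 := ℂ) (E := CN N))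
  have hint : ∀ ξ₁ ξ₂ : E3 → CN N, IsTest Ω ξ₁ → IsTest Ω ξ₂ →
      Integrable (fun x => inner ℂ (ξ₁ x) (ξ₂ x)) volume := fun ξ₁ ξ₂ h1 h2 =>
    integrable_inner_of_memLp (h1.memLp 2 _) (h2.memLp 2 _)
  have := integral_bilinear_fderiv_right_eq_neg_left_of_integrable (μ := (volume : Measure E3))
    (f := ψ) (g := χ) (v := EuclideanSpace.single i 1) (B := hB.toContinuousLinearMap)
    (hint _ _ (hψ.pd i) hχ) (hint _ _ hψ (hχ.pd i)) (hint _ _ hψ hχ)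
    (fun x _ => hψ.1.differentiable (by simp) x) (fun x _ => hχ.1.differentiable (by simp) x)
  rw [eq_neg_iff_add_eq_zero, add_comm, ← eq_neg_iff_add_eq_zero]
  exact this

theorem H10.hasWeakPartial (w : H10 N Ω) (i : Fin 3) :
    HasWeakPartial Ω i w.val (w.grad i) := by
  intro χ hχ
  refine H10.induction (p := fun w => ∫ x in Ω, inner ℂ (TDKS.pd i χ x) (w.val x)
    = - ∫ x in Ω, inner ℂ (χ x) (w.grad i x)) ?_ ?_ w
  · simp only [integral_inner_eq_inner_toLp ((hχ.pd i).memLp 2 _),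
      integral_inner_eq_inner_toLp (hχ.memLp 2 _)]
    exact isClosed_eq (continuous_const.inner H10.continuous_val)
      (continuous_const.inner (H10.continuous_grad i)).neg
  · intro w ψ hw
    have h1 : ∫ x in Ω, inner ℂ (TDKS.pd i χ x) (w.val x)
        = ∫ x in Ω, inner ℂ (TDKS.pd i χ x) (ψ x) := by
      refine integral_congr_ae ?_
      filter_upwards [hw.2.1] with x hx using by rw [hx]
    have h2 : ∫ x in Ω, inner ℂ (χ x) (w.grad i x)
        = ∫ x in Ω, inner ℂ (χ x) (TDKS.pd i ψ x) := by
      refine integral_congr_ae ?_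
      filter_upwards [hw.2.2 i] with x hx using by rw [hx]
    rw [h1, h2]
    exact hasWeakPartial_of_isTest hw.1 i χ hχ

/-- The embedding `H¹₀ → L²` is injective: a function determines its weak gradient. -/
theorem H10.eq_zero_of_val_eq_zero (hΩ : IsOpen Ω) {w : H10 N Ω} (h : w.val = 0) : w = 0 := by
  have hg : ∀ i, w.grad i = 0 := by
    intro i
    have hw := w.hasWeakPartial i
    rw [h] at hw
    have key := hΩ.ae_eq_zero_of_integral_contDiff_smul_eq_zero (μ := muO Ω)
      (f := (w.grad i : E3 → CN N))
      (((Lp.memLp (w.grad i)).locallyIntegrable one_le_two).locallyIntegrableOn _) ?_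
    · refine Lp.ext ?_
      filter_upwards [key, ae_restrict_mem hΩ.measurableSet, Lp.coeFn_zero (CN N) 2 (muO Ω)]
        with x h1 h2 h3
      rw [h1 h2, h3]
      rfl
    · intro φ h1 h2 h3
      have hi : Integrable (fun x => φ x • w.grad i x) (muO Ω) :=
        memLp_one_iff_integrable.1 ((Lp.memLp (w.grad i)).smul
          (h1.continuous.memLp_of_hasCompactSupport (p := 2) h2))
      refine ext_inner_left ℂ fun e => ?_
      rw [← integral_inner hi, inner_zero_right]
      have hχ : IsTest Ω (fun x => φ x • e) :=
        ⟨h1.smul contDiff_const, h2.smul_right (f' := fun _ => e),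
          (tsupport_smul_subset_left φ fun _ => e).trans h3⟩
      have h4 := hw _ hχ
      have h5 : ∫ x in Ω, inner ℂ (TDKS.pd i (fun x => φ x • e) x) ((0 : L2 N Ω) x) = 0 := by
        refine integral_eq_zero_of_ae ?_
        filter_upwards [Lp.coeFn_zero (CN N) 2 (muO Ω)] with x hx
        rw [hx]
        exact inner_zero_right _
      rw [h5, eq_comm, neg_eq_zero] at h4
      rw [← h4]
      refine integral_congr_ae (ae_of_all _ fun x => ?_)
      simp [inner_smul_right_eq_smul, inner_smul_left_eq_smul]
  have : ‖w‖ ^ 2 = 0 := by rw [w.norm_sq_eq]; simp [h, hg]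
  simpa using this

theorem IsTest.smul_left {φ : E3 → ℝ} (hφ : ContDiff ℝ ∞ φ) {χ : E3 → CN N} (hχ : IsTest Ω χ) :
    IsTest Ω (fun x => φ x • χ x) :=
  ⟨hφ.smul hχ.1, HasCompactSupport.smul_left (f := φ) hχ.2.1,
    (tsupport_smul_subset_right φ χ).trans hχ.2.2⟩

/-- Integration by parts against `φ w` with `w ∈ H¹₀` and a smooth weight `φ`, which need not
vanish on the boundary of `Ω`. -/
theorem H10.inner_weight_eq {i : Fin 3} {g h : L2 N Ω}
    (hgh : HasWeakPartial Ω i g h) {φ : E3 → ℝ} (hφ : ContDiff ℝ ∞ φ)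
    (hm : MemLp (fun x => (φ x : ℂ)) ∞ (muO Ω))
    (hm' : MemLp (fun x => ((TDKS.pd i φ x : ℝ) : ℂ)) ∞ (muO Ω)) (w : H10 N Ω) :
    inner ℂ (mulL hm (w.grad i)) g + inner ℂ (mulL hm' w.val) g = - inner ℂ (mulL hm w.val) h := by
  have hMc := (mulL (N := N) hm).continuous
  have hMc' := (mulL (N := N) hm').continuous
  refine H10.induction (p := fun w => inner ℂ (mulL hm (w.grad i)) g + inner ℂ (mulL hm' w.val) g
    = - inner ℂ (mulL hm w.val) h) ?_ ?_ w
  · exact isClosed_eq (((hMc.comp (H10.continuous_grad i)).inner continuous_const).add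
      ((hMc'.comp H10.continuous_val).inner continuous_const))
      ((hMc.comp H10.continuous_val).inner continuous_const).neg
  · intro w χ hw
    have hφχ := hw.1.smul_left hφ
    have key := hgh _ hφχ
    rw [integral_inner_eq_inner_toLp ((hφχ.pd i).memLp 2 _),
      integral_inner_eq_inner_toLp (hφχ.memLp 2 _)] at key
    have e1 : (hφχ.memLp 2 (muO Ω)).toLp = mulL hm w.val := by
      refine Lp.ext ?_
      filter_upwards [(hφχ.memLp 2 (muO Ω)).coeFn_toLp, mulL_coe hm w.val, hw.2.1] with x h1 h2 h3
      rw [h1, h2, h3]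
    have e2 : ((hφχ.pd i).memLp 2 (muO Ω)).toLp = mulL hm (w.grad i) + mulL hm' w.val := by
      refine Lp.ext ?_
      filter_upwards [((hφχ.pd i).memLp 2 (muO Ω)).coeFn_toLp, mulL_coe hm (w.grad i),
        mulL_coe hm' w.val, hw.2.1, hw.2.2 i, Lp.coeFn_add (mulL hm (w.grad i)) (mulL hm' w.val)]
        with x h1 h2 h3 h4 h5 h6
      rw [h1, h6, Pi.add_apply, h2, h3, h4, h5, pd_smul i (hφ.differentiable (by simp))
        (hw.1.1.differentiable (by simp))]
    rw [e1, e2, inner_add_left] at key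
    exact key

theorem contDiff_pd {φ : E3 → ℝ} (hφ : ContDiff ℝ ∞ φ) (i : Fin 3) : ContDiff ℝ ∞ (pd i φ) :=
  (hφ.fderiv_right (by simp)).clm_apply contDiff_const

/-- The real part of `H10.inner_weight_eq`, written with integrals. -/
theorem H10.integral_weight_eq (hΩ : IsOpen Ω) (hΩb : Bornology.IsBounded Ω) {i : Fin 3}
    {g h : L2 N Ω} (hgh : HasWeakPartial Ω i g h) {φ : E3 → ℝ} (hφ : ContDiff ℝ ∞ φ)
    (w : H10 N Ω) :
    (∫ x in Ω, φ x * (inner ℂ (w.grad i x) (g x)).re)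
      + ∫ x in Ω, TDKS.pd i φ x * (inner ℂ (w.val x) (g x)).re
      = - ∫ x in Ω, φ x * (inner ℂ (w.val x) (h x)).re := by
  have key : ∀ {m : E3 → ℝ} (hm : MemLp (fun x => (m x : ℂ)) ∞ (muO Ω)) (a b : L2 N Ω),
      (inner ℂ (mulL hm a) b).re = ∫ x in Ω, m x * (inner ℂ (a x) (b x)).re := by
    intro m hm a b
    rw [L2.inner_def]
    have := integral_re (𝕜 := ℂ) (L2.integrable_inner (𝕜 := ℂ) (mulL hm a) b)
    simp only [RCLike.re_to_complex] at this
    rw [← this]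
    refine integral_congr_ae ?_
    filter_upwards [mulL_coe hm a] with x hx
    rw [hx, inner_smul_left_eq_smul, Complex.smul_re, smul_eq_mul]
  have := congrArg Complex.re (H10.inner_weight_eq hgh hφ
    (memLp_top_of_continuous hΩb hΩ.measurableSet hφ.continuous)
    (memLp_top_of_continuous hΩb hΩ.measurableSet (contDiff_pd hφ i).continuous) w)
  rwa [Complex.add_re, Complex.neg_re, key, key, key] at this

/-! ### Uniqueness in `H¹₀`, from a Lipschitz bound on the lower order terms -/

section Dual

variable {V H : Type*} [NormedAddCommGroup V] [InnerProductSpace ℂ V] [CompleteSpace V]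
  [NormedAddCommGroup H] [InnerProductSpace ℂ H] [CompleteSpace H]

/-- The Riesz representative of a bounded antilinear functional. -/
noncomputable def riesz (ℓ : V →L⋆[ℂ] ℂ) : V :=
  (InnerProductSpace.toDual ℂ V).symm (((starL ℂ : ℂ ≃L⋆[ℂ] ℂ) : ℂ →L⋆[ℂ] ℂ).comp ℓ)

theorem inner_riesz (ℓ : V →L⋆[ℂ] ℂ) (w : V) : inner ℂ w (riesz ℓ) = ℓ w := by
  rw [← inner_conj_symm, riesz, InnerProductSpace.toDual_symm_apply]
  simp

theorem riesz_sub (ℓ ℓ' : V →L⋆[ℂ] ℂ) : riesz (ℓ - ℓ') = riesz ℓ - riesz ℓ' := by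
  refine ext_inner_left ℂ fun w => ?_
  rw [inner_sub_right, inner_riesz, inner_riesz, inner_riesz]
  rfl

theorem norm_riesz_le (ℓ : V →L⋆[ℂ] ℂ) : ‖riesz ℓ‖ ≤ ‖ℓ‖ := by
  have h : ‖riesz ℓ‖ * ‖riesz ℓ‖ ≤ ‖ℓ‖ * ‖riesz ℓ‖ := by
    rw [← sq, ← re_inner_self, inner_riesz]
    exact (Complex.re_le_norm _).trans (ℓ.le_opNorm _)
  rcases (norm_nonneg (riesz ℓ)).eq_or_lt with h0 | h0
  · rw [← h0]; positivity
  · exact le_of_mul_le_mul_right h h0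

theorem continuous_riesz : Continuous (riesz : (V →L⋆[ℂ] ℂ) → V) := by
  refine LipschitzWith.continuous (K := 1) (LipschitzWith.of_dist_le_mul fun ℓ ℓ' => ?_)
  rw [dist_eq_norm, dist_eq_norm, ← riesz_sub, NNReal.coe_one, one_mul]
  exact norm_riesz_le _

/-- `eq_zero_of_schrodinger` for a time derivative with values in the antidual of `V`, and with the
principal part `⟨w, φ⟩_V - ⟨w, φ⟩_H`: the second term is of order zero and only adds `1` to `k`. -/
theorem eq_zero_of_schrodinger_antidual (hT : 0 < T) (ι : V →L[ℂ] H) {φ : ℝ → V}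
    (φ' : Lp (V →L⋆[ℂ] ℂ) 2 (muT T)) {c : ℝ → H} {k : ℝ → ℝ}
    (hc : ContinuousOn c (Icc 0 T)) (hc0 : c 0 = 0) (hcφ : ∀ᵐ t ∂(muT T), c t = ι (φ t))
    (hder : ∀ η : ℝ → ℝ, IsTest (Ioo 0 T) η → ∀ w : V,
      ∫ t in Ioo 0 T, ((deriv η t : ℝ) : ℂ) * inner ℂ (ι w) (ι (φ t))
        = - ∫ t in Ioo 0 T, (η t : ℂ) * φ' t w)
    (hk : Integrable k (muT T)) (hk0 : ∀ᵐ t ∂(muT T), 0 ≤ k t)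
    (heq : ∀ᵐ t ∂(muT T), ∀ w : V,
      ‖Complex.I * φ' t w - (inner ℂ w (φ t) - inner ℂ (ι w) (ι (φ t)))‖
        ≤ k t * ‖ι (φ t)‖ * ‖ι w‖) :
    ∀ t ∈ Icc 0 T, c t = 0 := by
  have hφ' : Integrable φ' (muT T) := (Lp.memLp φ').integrable one_le_two
  have hp : Integrable (fun t => riesz (φ' t)) (muT T) :=
    hφ'.norm.mono' (continuous_riesz.comp_aestronglyMeasurable hφ'.1)
      (ae_of_all _ fun t => norm_riesz_le _)
  refine eq_zero_of_schrodinger hT ι (p := fun t => riesz (φ' t)) (k := fun t => k t + 1) hc hc0 hcφ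
    hp (fun η hη w => ?_) (hk.add (integrable_const 1)) (hk0.mono fun t ht => by positivity) ?_
  · simp only [inner_riesz]
    rw [← hder η hη w]
    refine integral_congr_ae ?_
    filter_upwards [hcφ] with t ht
    rw [ht]
  · filter_upwards [heq] with t ht w
    rw [inner_riesz]
    have h := ht w
    have e : Complex.I * φ' t w - inner ℂ w (φ t)
        = (Complex.I * φ' t w - (inner ℂ w (φ t) - inner ℂ (ι w) (ι (φ t))))
          - inner ℂ (ι w) (ι (φ t)) := by ring
    rw [e]
    refine (norm_sub_le _ _).trans ?_
    rw [add_mul, add_mul, one_mul, mul_comm ‖ι (φ t)‖]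
    exact add_le_add h (norm_inner_le_norm _ _)

end Dual

/-- A function in `W` with initial value `0` vanishes if `i Φ' + ΔΦ` is bounded by `k(t) ‖Φ(t)‖` in
`L²`, with an integrable `k`. -/
theorem eq_zero_of_isTimeDeriv (hΩ : IsOpen Ω) (hT : 0 < T) {Φ : X N Ω T} {Φ' : Xstar N Ω T}
    (hd : IsTimeDeriv Φ Φ') (h0 : HasInitialValue Φ 0) {k : ℝ → ℝ} (hk : Integrable k (muT T))
    (hk0 : ∀ᵐ t ∂(muT T), 0 ≤ k t)
    (heq : ∀ᵐ t ∂(muT T), ∀ w : H10 N Ω,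
      ‖Complex.I * Φ' t w - ∑ i, sp Ω ((Φ t).grad i) (w.grad i)‖
        ≤ k t * ‖(Φ t).val‖ * ‖w.val‖) : Φ = 0 := by
  obtain ⟨c, hc, hcΦ, hc0⟩ := h0
  have heq' : ∀ᵐ t ∂(muT T), ∀ w : H10 N Ω,
      ‖Complex.I * Φ' t w - (inner ℂ w (Φ t) - inner ℂ w.val (Φ t).val)‖
        ≤ k t * ‖(Φ t).val‖ * ‖w.val‖ := by
    filter_upwards [heq] with t ht w
    have e : inner ℂ w (Φ t) - inner ℂ w.val (Φ t).val
        = ∑ i, sp Ω ((Φ t).grad i) (w.grad i) := by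
      rw [H10.inner_eq, add_sub_cancel_left]
      rfl
    rw [e]
    exact ht w
  have key := eq_zero_of_schrodinger_antidual (V := H10 N Ω) (H := L2 N Ω) hT H10.valL (φ := Φ)
  have key' := key Φ' (c := c) (k := k)
  have hcz := key' hc hc0 hcΦ hd hk hk0 heq'
  rw [Lp.eq_zero_iff_ae_eq_zero]
  filter_upwards [hcΦ, ae_restrict_mem measurableSet_Ioo] with t h1 h2
  exact H10.eq_zero_of_val_eq_zero hΩ (h1 ▸ hcz t (Ioo_subset_Icc_self h2))

/-! ### Hardy's inequality -/

theorem hasFDerivAt_radial (x : E3) {f : ℝ → ℝ} {f' : ℝ} {y : E3}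
    (hf : HasDerivAt f f' (‖y - x‖ ^ 2)) :
    HasFDerivAt (fun y => f (‖y - x‖ ^ 2)) (f' • (2 • innerSL ℝ (y - x))) y := by
  have h1 : HasFDerivAt (fun y : E3 => ‖y - x‖ ^ 2) (2 • innerSL ℝ (y - x)) y := by
    have := ((hasFDerivAt_id y).sub_const x).norm_sq
    simpa using this
  exact hf.comp_hasFDerivAt y h1

theorem pd_radial (x : E3) {f : ℝ → ℝ} {f' : ℝ} {y : E3} (i : Fin 3)
    (hf : HasDerivAt f f' (‖y - x‖ ^ 2)) :
    pd i (fun y => f (‖y - x‖ ^ 2)) y = 2 * (y i - x i) * f' := by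
  rw [pd, (hasFDerivAt_radial x hf).fderiv]
  simp [EuclideanSpace.inner_single_right]
  ring

theorem pd_coord_mul_radial (x : E3) {f : ℝ → ℝ} {f' : ℝ} {y : E3} (i : Fin 3)
    (hf : HasDerivAt f f' (‖y - x‖ ^ 2)) :
    pd i (fun y => (y i - x i) * f (‖y - x‖ ^ 2)) y
      = f (‖y - x‖ ^ 2) + 2 * (y i - x i) ^ 2 * f' := by
  have h1 : HasFDerivAt (fun y : E3 => y i - x i) (EuclideanSpace.proj i : E3 →L[ℝ] ℝ) y :=
    (EuclideanSpace.proj i : E3 →L[ℝ] ℝ).hasFDerivAt.sub_const _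
  rw [pd, (h1.fun_mul (hasFDerivAt_radial x hf)).fderiv]
  simp [EuclideanSpace.inner_single_right]
  ring

theorem norm_sub_sq_eq (x y : E3) : ‖y - x‖ ^ 2 = ∑ i, (y i - x i) ^ 2 := by
  rw [EuclideanSpace.real_norm_sq_eq]; rfl

theorem contDiff_coord_sub (x : E3) (i : Fin 3) : ContDiff ℝ ∞ fun y : E3 => y i - x i :=
  (EuclideanSpace.proj i : E3 →L[ℝ] ℝ).contDiff.sub contDiff_const

theorem contDiff_add_norm_sq (x : E3) (δ : ℝ) : ContDiff ℝ ∞ fun y : E3 => δ + ‖y - x‖ ^ 2 :=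
  contDiff_const.add ((contDiff_id.sub contDiff_const).norm_sq ℝ)

theorem L2.integrable_norm_sq (f : L2 N Ω) : Integrable (fun y => ‖f y‖ ^ 2) (muO Ω) :=
  (Lp.memLp f).integrable_norm_pow two_ne_zero

theorem L2.integral_norm_sq (f : L2 N Ω) : ∫ y in Ω, ‖f y‖ ^ 2 = ‖f‖ ^ 2 := by
  have h := integral_re (𝕜 := ℂ) (MeasureTheory.L2.integrable_inner (𝕜 := ℂ) f f)
  rw [← MeasureTheory.L2.inner_def] at h
  simp only [RCLike.re_to_complex, re_inner_self] at h
  exact h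

/-- Products of a continuous weight with an integrable function on the bounded set `Ω`. -/
theorem integrable_continuous_mul (hΩ : IsOpen Ω) (hΩb : Bornology.IsBounded Ω) {m f : E3 → ℝ}
    (hm : Continuous m) (hf : Integrable f (muO Ω)) : Integrable (fun y => m y * f y) (muO Ω) := by
  obtain ⟨C, hC⟩ := hΩb.isCompact_closure.exists_bound_of_continuousOn hm.continuousOn
  refine hf.bdd_mul (c := C) hm.aestronglyMeasurable ?_
  filter_upwards [ae_restrict_mem hΩ.measurableSet] with x hx using hC x (subset_closure hx)

theorem integrable_re_inner (f g : L2 N Ω) :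
    Integrable (fun y => (inner ℂ (f y) (g y)).re) (muO Ω) :=
  (MeasureTheory.L2.integrable_inner (𝕜 := ℂ) f g).re

/-- The regularised Hardy inequality, from the vector field `(y - x) / (δ + |y - x|²)`, whose
divergence is at least `1 / (δ + |y - x|²)`. -/
theorem hardy_regularized (hΩ : IsOpen Ω) (hΩb : Bornology.IsBounded Ω) (w : H10 N Ω) (x : E3)
    {δ : ℝ} (hδ : 0 < δ) :
    ∫ y in Ω, (δ + ‖y - x‖ ^ 2)⁻¹ * ‖w.val y‖ ^ 2 ≤ 4 * ‖w‖ ^ 2 := by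
  have hq : ∀ y : E3, 0 < δ + ‖y - x‖ ^ 2 := fun y => by positivity
  have hqi : ContDiff ℝ ∞ fun y : E3 => (δ + ‖y - x‖ ^ 2)⁻¹ :=
    (contDiff_add_norm_sq x δ).inv fun y => (hq y).ne'
  have hh : ∀ i, ContDiff ℝ ∞ fun y : E3 => (y i - x i) * (δ + ‖y - x‖ ^ 2)⁻¹ := fun i =>
    (contDiff_coord_sub x i).mul hqi
  have hpd : ∀ i y, pd i (fun y : E3 => (y i - x i) * (δ + ‖y - x‖ ^ 2)⁻¹) y
      = (δ + ‖y - x‖ ^ 2)⁻¹ + 2 * (y i - x i) ^ 2 * -((δ + ‖y - x‖ ^ 2) ^ 2)⁻¹ := fun i y => by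
    refine pd_coord_mul_radial x (f := fun t => (δ + t)⁻¹) i ?_
    exact (((hasDerivAt_id' (‖y - x‖ ^ 2)).const_add δ).fun_inv (hq y).ne').congr_deriv
      (by rw [neg_div, one_div])
  have hI : ∀ f : E3 → ℝ, Integrable f (muO Ω) →
      Integrable (fun y => (δ + ‖y - x‖ ^ 2)⁻¹ * f y) (muO Ω) := fun f hf =>
    integrable_continuous_mul hΩ hΩb hqi.continuous hf
  have hibp : ∀ i, ∫ y in Ω, pd i (fun y : E3 => (y i - x i) * (δ + ‖y - x‖ ^ 2)⁻¹) y
      * ‖w.val y‖ ^ 2 = ∫ y in Ω, -2 * (((y i - x i) * (δ + ‖y - x‖ ^ 2)⁻¹)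
        * (inner ℂ (w.val y) (w.grad i y)).re) := fun i => by
    have h := H10.integral_weight_eq hΩ hΩb (w.hasWeakPartial i) (hh i) w
    have hs : ∀ y, (inner ℂ (w.grad i y) (w.val y)).re = (inner ℂ (w.val y) (w.grad i y)).re :=
      fun y => by rw [← inner_conj_symm, Complex.conj_re]
    simp only [hs, re_inner_self] at h
    rw [integral_const_mul]
    linarith
  have hle : ∀ i, ∫ y in Ω, pd i (fun y : E3 => (y i - x i) * (δ + ‖y - x‖ ^ 2)⁻¹) y
      * ‖w.val y‖ ^ 2 ≤ ∫ y in Ω, (1 / 2 * (((y i - x i) * (δ + ‖y - x‖ ^ 2)⁻¹) ^ 2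
        * ‖w.val y‖ ^ 2) + 2 * ‖w.grad i y‖ ^ 2) := fun i => by
    rw [hibp i]
    refine integral_mono ((integrable_continuous_mul hΩ hΩb (hh i).continuous
      (integrable_re_inner _ _)).const_mul _)
      (((integrable_continuous_mul hΩ hΩb ((hh i).continuous.pow 2)
      (L2.integrable_norm_sq _)).const_mul _).add ((L2.integrable_norm_sq _).const_mul _)) ?_
    intro y
    dsimp only
    have h1 := abs_le.1 ((Complex.abs_re_le_norm _).trans
      (norm_inner_le_norm (𝕜 := ℂ) (w.val y) (w.grad i y)))
    generalize (y i - x i) * (δ + ‖y - x‖ ^ 2)⁻¹ = a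
    generalize (inner ℂ (w.val y) (w.grad i y)).re = b at h1
    have h2 : -2 * (a * b) ≤ 2 * (|a| * (‖w.val y‖ * ‖w.grad i y‖)) := by
      have h3 : |a * b| ≤ |a| * (‖w.val y‖ * ‖w.grad i y‖) := by
        rw [abs_mul]; gcongr; exact abs_le.2 h1
      linarith [(abs_le.1 h3).1]
    refine h2.trans ?_
    rw [← sq_abs a]
    nlinarith [sq_nonneg (|a| * ‖w.val y‖ - 2 * ‖w.grad i y‖)]
  have hsum := Finset.sum_le_sum fun i (_ : i ∈ Finset.univ) => hle i
  rw [← integral_finsetSum, ← integral_finsetSum] at hsum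
  rotate_left
  · exact fun i _ => ((integrable_continuous_mul hΩ hΩb ((hh i).continuous.pow 2)
      (L2.integrable_norm_sq _)).const_mul _).add ((L2.integrable_norm_sq _).const_mul _)
  · exact fun i _ => integrable_continuous_mul hΩ hΩb (contDiff_pd (hh i) i).continuous
      (L2.integrable_norm_sq _)
  have hiq := hI _ (L2.integrable_norm_sq w.val)
  have hlow : ∫ y in Ω, (δ + ‖y - x‖ ^ 2)⁻¹ * ‖w.val y‖ ^ 2 ≤ ∫ y in Ω, ∑ i,
      pd i (fun y : E3 => (y i - x i) * (δ + ‖y - x‖ ^ 2)⁻¹) y * ‖w.val y‖ ^ 2 := by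
    refine integral_mono hiq (integrable_finsetSum _ fun i _ => integrable_continuous_mul hΩ hΩb
      (contDiff_pd (hh i) i).continuous (L2.integrable_norm_sq _)) fun y => ?_
    dsimp only
    rw [← Finset.sum_mul]
    refine mul_le_mul_of_nonneg_right ?_ (sq_nonneg _)
    simp only [hpd]
    rw [Finset.sum_add_distrib, ← Finset.sum_mul, ← Finset.mul_sum, ← norm_sub_sq_eq]
    simp only [Finset.sum_const, Finset.card_univ, Fintype.card_fin, nsmul_eq_mul]
    have h1 := hq y
    generalize ‖y - x‖ ^ 2 = r at h1
    have : ((3 : ℕ) : ℝ) * (δ + r)⁻¹ + 2 * r * -((δ + r) ^ 2)⁻¹ - (δ + r)⁻¹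
        = 2 * δ * ((δ + r) ^ 2)⁻¹ := by field_simp; push_cast; ring
    have h2 : 0 ≤ 2 * δ * ((δ + r) ^ 2)⁻¹ := by positivity
    linarith
  have hup : ∫ y in Ω, ∑ i, (1 / 2 * (((y i - x i) * (δ + ‖y - x‖ ^ 2)⁻¹) ^ 2
        * ‖w.val y‖ ^ 2) + 2 * ‖w.grad i y‖ ^ 2)
      ≤ ∫ y in Ω, (1 / 2 * ((δ + ‖y - x‖ ^ 2)⁻¹ * ‖w.val y‖ ^ 2)
        + ∑ i, 2 * ‖w.grad i y‖ ^ 2) := by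
    refine integral_mono (integrable_finsetSum _ fun i _ =>
      ((integrable_continuous_mul hΩ hΩb ((hh i).continuous.pow 2)
      (L2.integrable_norm_sq _)).const_mul _).add ((L2.integrable_norm_sq _).const_mul _))
      ((hiq.const_mul _).add (integrable_finsetSum _ fun i _ =>
        (L2.integrable_norm_sq _).const_mul _)) fun y => ?_
    dsimp only
    rw [Finset.sum_add_distrib]
    refine add_le_add ?_ le_rfl
    rw [← Finset.mul_sum, ← Finset.sum_mul]
    refine mul_le_mul_of_nonneg_left (mul_le_mul_of_nonneg_right ?_ (sq_nonneg _)) (by norm_num)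
    simp only [mul_pow]
    rw [← Finset.sum_mul, ← norm_sub_sq_eq]
    have h1 := hq y
    have h2 : 0 ≤ ‖y - x‖ ^ 2 := by positivity
    generalize ‖y - x‖ ^ 2 = r at h1 h2
    rw [inv_pow, ← div_eq_mul_inv, inv_eq_one_div, div_le_div_iff₀ (by positivity) h1]
    nlinarith
  have hfin := hlow.trans (hsum.trans hup)
  rw [integral_add (hiq.const_mul _) (integrable_finsetSum _ fun i _ =>
        (L2.integrable_norm_sq _).const_mul _), integral_const_mul, integral_finsetSum _ (fun i _ =>
        (L2.integrable_norm_sq _).const_mul _)] at hfin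
  simp only [integral_const_mul, L2.integral_norm_sq] at hfin
  rw [← Finset.mul_sum] at hfin
  linarith [w.sum_norm_grad_sq_le]

/-- **Hardy's inequality** in `H¹₀`, with the singularity at an arbitrary point, as the limit `δ → 0` of
the regularised inequality by Fatou's lemma. At `y = x` the integrand has the value `0`. -/
theorem hardy (hΩ : IsOpen Ω) (hΩb : Bornology.IsBounded Ω) (w : H10 N Ω) (x : E3) :
    Integrable (fun y => (‖w.val y‖ / ‖x - y‖) ^ 2) (muO Ω) ∧
      ∫ y in Ω, (‖w.val y‖ / ‖x - y‖) ^ 2 ≤ 4 * ‖w‖ ^ 2 := by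
  have hwm : Measurable fun y => ‖w.val y‖ := (Lp.stronglyMeasurable w.val).norm.measurable
  have hm : Measurable fun y : E3 => ‖x - y‖ := by fun_prop
  have hle : ∫⁻ y in Ω, ENNReal.ofReal ((‖w.val y‖ / ‖x - y‖) ^ 2)
      ≤ ENNReal.ofReal (4 * ‖w‖ ^ 2) := by
    have hδ : ∀ n : ℕ, (0 : ℝ) < 1 / ((n : ℝ) + 1) := fun n => Nat.one_div_pos_of_nat
    have hlim : ∀ y, ENNReal.ofReal ((‖w.val y‖ / ‖x - y‖) ^ 2) ≤ liminf (fun n : ℕ =>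
        ENNReal.ofReal ((1 / ((n : ℝ) + 1) + ‖y - x‖ ^ 2)⁻¹ * ‖w.val y‖ ^ 2)) atTop := by
      intro y
      by_cases hxy : ‖x - y‖ = 0
      · simp [hxy]
      · have h1 : Tendsto (fun n : ℕ => 1 / ((n : ℝ) + 1) + ‖y - x‖ ^ 2) atTop
            (𝓝 (0 + ‖y - x‖ ^ 2)) := tendsto_one_div_add_atTop_nhds_zero_nat.add_const _
        have h2 := (h1.inv₀ (by rw [zero_add, norm_sub_rev]; positivity)).mul_const (‖w.val y‖ ^ 2)
        have h3 := ENNReal.tendsto_ofReal h2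
        rw [h3.liminf_eq, zero_add, norm_sub_rev y x, div_pow, div_eq_inv_mul]
    refine (lintegral_mono hlim).trans ((lintegral_liminf_le fun n => ?_).trans ?_)
    · have : Measurable fun y : E3 => ‖y - x‖ := by fun_prop
      fun_prop
    · refine liminf_le_of_le (by isBoundedDefault) fun b hb => ?_
      obtain ⟨n, hn⟩ := hb.exists
      refine hn.trans ?_
      rw [← ofReal_integral_eq_lintegral_ofReal]
      · exact ENNReal.ofReal_le_ofReal (hardy_regularized hΩ hΩb w x (hδ n))
      · refine integrable_continuous_mul hΩ hΩb ?_ (L2.integrable_norm_sq _)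
        exact (contDiff_add_norm_sq x _).continuous.inv₀ fun y => by have := hδ n; positivity
      · exact ae_of_all _ fun y => by have := hδ n; positivity
  have hint : Integrable (fun y => (‖w.val y‖ / ‖x - y‖) ^ 2) (muO Ω) := by
    refine ⟨((hwm.div hm).pow_const 2).aestronglyMeasurable, ?_⟩
    rw [hasFiniteIntegral_iff_ofReal (ae_of_all _ fun y => by positivity)]
    exact hle.trans_lt ENNReal.ofReal_lt_top
  refine ⟨hint, ?_⟩
  rw [← ofReal_integral_eq_lintegral_ofReal hint (ae_of_all _ fun y => by positivity)] at hle
  exact (ENNReal.ofReal_le_ofReal_iff (by positivity)).1 hle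

/-- The Cauchy-Schwarz inequality for integrals. -/
theorem integral_mul_le_of_sq_le {α : Type*} [MeasurableSpace α] {μ : Measure α} {f g : α → ℝ}
    (hf : MemLp f 2 μ) (hg : MemLp g 2 μ) {A B : ℝ} (hA : 0 ≤ A) (hB : 0 ≤ B)
    (hfA : ∫ x, f x ^ 2 ∂μ ≤ A ^ 2) (hgB : ∫ x, g x ^ 2 ∂μ ≤ B ^ 2) :
    ∫ x, f x * g x ∂μ ≤ A * B := by
  have hn : ∀ {h : α → ℝ} (hh : MemLp h 2 μ) {C : ℝ}, 0 ≤ C → ∫ x, h x ^ 2 ∂μ ≤ C ^ 2 →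
      ‖hh.toLp‖ ≤ C := by
    intro h hh C hC hle
    refine le_of_sq_le_sq ?_ hC
    rw [← real_inner_self_eq_norm_sq, MeasureTheory.L2.inner_def]
    refine le_trans (le_of_eq (integral_congr_ae ?_)) hle
    filter_upwards [hh.coeFn_toLp] with x hx
    rw [hx, real_inner_self_eq_norm_sq, Real.norm_eq_abs, sq_abs]
  have e : ∫ x, f x * g x ∂μ = inner ℝ hf.toLp hg.toLp := by
    rw [MeasureTheory.L2.inner_def]
    refine integral_congr_ae ?_
    filter_upwards [hf.coeFn_toLp, hg.coeFn_toLp] with x h1 h2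
    rw [h1, h2, real_inner_eq_re_inner ℝ]
    simp [mul_comm]
  rw [e]
  exact (real_inner_le_norm _ _).trans
    (mul_le_mul (hn hf hA hfA) (hn hg hB hgB) (norm_nonneg _) hA)

theorem memLp_norm (f : L2 N Ω) : MemLp (fun y => ‖f y‖) 2 (muO Ω) := (Lp.memLp f).norm

/-- The Coulomb potential of a product `|f| |w|` with `f ∈ L²` and `w ∈ H¹₀` is bounded. -/
theorem coulomb_bound (hΩ : IsOpen Ω) (hΩb : Bornology.IsBounded Ω) (f : L2 N Ω) (w : H10 N Ω)
    (x : E3) : Integrable (fun y => ‖f y‖ * (‖w.val y‖ / ‖x - y‖)) (muO Ω) ∧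
      ∫ y in Ω, ‖f y‖ * (‖w.val y‖ / ‖x - y‖) ≤ 2 * ‖f‖ * ‖w‖ := by
  obtain ⟨h1, h2⟩ := hardy hΩ hΩb w x
  have hm : Measurable fun y : E3 => ‖x - y‖ := by fun_prop
  have hw : MemLp (fun y => ‖w.val y‖ / ‖x - y‖) 2 (muO Ω) := by
    rw [memLp_two_iff_integrable_sq]
    · exact h1
    · exact ((Lp.stronglyMeasurable w.val).norm.measurable.div hm).aestronglyMeasurable
  refine ⟨(memLp_norm f).integrable_mul hw, ?_⟩
  have := integral_mul_le_of_sq_le (memLp_norm f) hw (norm_nonneg f)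
    (B := 2 * ‖w‖) (by positivity) (L2.integral_norm_sq f).le (h2.trans (by ring_nf; rfl))
  linarith

/-! ### An `L^∞` bound for functions in `H¹₀` with second derivatives in `L²` -/

theorem hasDerivAt_inv_sqrt {δ t : ℝ} (h : 0 < δ + t) :
    HasDerivAt (fun t => (√(δ + t))⁻¹) (-(1 / 2) * ((√(δ + t))⁻¹) ^ 3) t := by
  refine (((((hasDerivAt_id' t).const_add δ).sqrt h.ne').fun_inv
    (Real.sqrt_ne_zero'.2 h))).congr_deriv ?_
  have := Real.sqrt_pos.2 h
  field_simp

theorem hasDerivAt_inv_sqrt_cube {δ t : ℝ} (h : 0 < δ + t) :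
    HasDerivAt (fun t => -((√(δ + t))⁻¹) ^ 3) (3 / 2 * ((√(δ + t))⁻¹) ^ 5) t := by
  refine ((hasDerivAt_inv_sqrt h).fun_pow 3).fun_neg.congr_deriv ?_
  push_cast
  ring

/-- The integral inequality `½ ∫ (-Δφ) |u|² ≤ ∫ φ |u| |Δu|` for the regularised Newtonian kernel
`φ(y) = (δ + |y - x|²)^{-1/2}`, for which `-Δφ = 3 δ (δ + |y - x|²)^{-5/2}`; the equation for `u` is
tested with `φ u ∈ H¹₀`, so no regularity of the boundary of `Ω` enters. The right-hand side is
estimated by Hardy's inequality. -/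
theorem integral_newton_kernel_le (hΩ : IsOpen Ω) (hΩb : Bornology.IsBounded Ω) (u : H10 N Ω)
    {h : Fin 3 → L2 N Ω} (hu : ∀ i, HasWeakPartial Ω i (u.grad i) (h i)) (x : E3)
    {δ : ℝ} (hδ : 0 < δ) :
    ∫ y in Ω, 3 * δ * ((√(δ + ‖y - x‖ ^ 2))⁻¹) ^ 5 * ‖u.val y‖ ^ 2
      ≤ 12 * ‖u‖ ^ 2 + ∑ i, ‖h i‖ ^ 2 := by
  have hq : ∀ y : E3, 0 < δ + ‖y - x‖ ^ 2 := fun y => by positivity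
  have hs : ContDiff ℝ ∞ fun y : E3 => (√(δ + ‖y - x‖ ^ 2))⁻¹ :=
    ((contDiff_add_norm_sq x δ).sqrt fun y => (hq y).ne').inv
      fun y => (Real.sqrt_ne_zero'.2 (hq y))
  have hpd : ∀ i, pd i (fun y : E3 => (√(δ + ‖y - x‖ ^ 2))⁻¹)
      = fun y => (y i - x i) * -((√(δ + ‖y - x‖ ^ 2))⁻¹) ^ 3 := fun i => funext fun y => by
    rw [pd_radial x (f := fun t => (√(δ + t))⁻¹) i (hasDerivAt_inv_sqrt (hq y))]
    ring
  have hpd2 : ∀ i y, pd i (fun y : E3 => (y i - x i) * -((√(δ + ‖y - x‖ ^ 2))⁻¹) ^ 3) y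
      = -((√(δ + ‖y - x‖ ^ 2))⁻¹) ^ 3
        + 3 * (y i - x i) ^ 2 * ((√(δ + ‖y - x‖ ^ 2))⁻¹) ^ 5 := fun i y => by
    rw [pd_coord_mul_radial x (f := fun t => -((√(δ + t))⁻¹) ^ 3) i
      (hasDerivAt_inv_sqrt_cube (hq y))]
    ring
  have hs2 : ∀ i, ContDiff ℝ ∞ fun y : E3 => (y i - x i) * -((√(δ + ‖y - x‖ ^ 2))⁻¹) ^ 3 :=
    fun i => hpd i ▸ contDiff_pd hs i
  -- test `-∂_i² u` with `φ u`, and drop the nonnegative term `∫ φ |∂_i u|²`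
  have h1 : ∀ i, ∫ y in Ω, ((y i - x i) * -((√(δ + ‖y - x‖ ^ 2))⁻¹) ^ 3)
        * (inner ℂ (u.val y) (u.grad i y)).re
      ≤ 2 * ‖u‖ ^ 2 + 1 / 2 * ‖h i‖ ^ 2 := fun i => by
    have key := H10.integral_weight_eq hΩ hΩb (hu i) hs u
    rw [hpd i] at key
    have hpos : 0 ≤ ∫ y in Ω, (√(δ + ‖y - x‖ ^ 2))⁻¹ * (inner ℂ (u.grad i y) (u.grad i y)).re :=
      integral_nonneg fun y => mul_nonneg (by positivity) (by rw [re_inner_self]; positivity)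
    have hi1 : Integrable (fun y => (δ + ‖y - x‖ ^ 2)⁻¹ * ‖u.val y‖ ^ 2) (muO Ω) :=
      integrable_continuous_mul hΩ hΩb ((contDiff_add_norm_sq x δ).continuous.inv₀
        fun y => (hq y).ne') (L2.integrable_norm_sq _)
    have hup : ∫ y in Ω, -((√(δ + ‖y - x‖ ^ 2))⁻¹ * (inner ℂ (u.val y) (h i y)).re)
        ≤ ∫ y in Ω, (1 / 2 * ((δ + ‖y - x‖ ^ 2)⁻¹ * ‖u.val y‖ ^ 2) + 1 / 2 * ‖h i y‖ ^ 2) := by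
      refine integral_mono (integrable_continuous_mul hΩ hΩb hs.continuous
        (integrable_re_inner _ _)).neg ((hi1.const_mul _).add
        ((L2.integrable_norm_sq _).const_mul _)) fun y => ?_
      dsimp only
      have h1 := (abs_le.1 ((Complex.abs_re_le_norm _).trans
        (norm_inner_le_norm (𝕜 := ℂ) (u.val y) (h i y)))).1
      have h2 : (δ + ‖y - x‖ ^ 2)⁻¹ = ((√(δ + ‖y - x‖ ^ 2))⁻¹) ^ 2 := by
        rw [inv_pow, Real.sq_sqrt (hq y).le]
      have h3 : 0 ≤ (√(δ + ‖y - x‖ ^ 2))⁻¹ := by positivity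
      rw [h2]
      generalize (√(δ + ‖y - x‖ ^ 2))⁻¹ = s at h3
      generalize (inner ℂ (u.val y) (h i y)).re = b at h1
      have h4 : -(s * b) ≤ s * (‖u.val y‖ * ‖h i y‖) := by nlinarith
      nlinarith [sq_nonneg (s * ‖u.val y‖ - ‖h i y‖)]
    rw [integral_neg, integral_add (hi1.const_mul _) ((L2.integrable_norm_sq _).const_mul _),
      integral_const_mul, integral_const_mul, L2.integral_norm_sq] at hup
    have := hardy_regularized hΩ hΩb u x hδ
    linarith
  -- integrate by parts once more, in `2 Re ⟨u, ∂_i u⟩ = ∂_i |u|²`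
  have h2 : ∀ i, ∫ y in Ω, pd i (fun y : E3 => (y i - x i) * -((√(δ + ‖y - x‖ ^ 2))⁻¹) ^ 3) y
      * ‖u.val y‖ ^ 2 = -2 * ∫ y in Ω, ((y i - x i) * -((√(δ + ‖y - x‖ ^ 2))⁻¹) ^ 3)
        * (inner ℂ (u.val y) (u.grad i y)).re := fun i => by
    have key := H10.integral_weight_eq hΩ hΩb (u.hasWeakPartial i) (hs2 i) u
    have hsymm : ∀ y, (inner ℂ (u.grad i y) (u.val y)).re = (inner ℂ (u.val y) (u.grad i y)).re :=
      fun y => by rw [← inner_conj_symm, Complex.conj_re]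
    simp only [hsymm, re_inner_self] at key
    linarith
  have h3 : ∫ y in Ω, 3 * δ * ((√(δ + ‖y - x‖ ^ 2))⁻¹) ^ 5 * ‖u.val y‖ ^ 2
      = -∑ i, ∫ y in Ω, pd i (fun y : E3 => (y i - x i) * -((√(δ + ‖y - x‖ ^ 2))⁻¹) ^ 3) y
        * ‖u.val y‖ ^ 2 := by
    rw [← integral_finsetSum _ fun i _ => integrable_continuous_mul hΩ hΩb
      (contDiff_pd (hs2 i) i).continuous (L2.integrable_norm_sq _), ← integral_neg]
    refine integral_congr_ae (ae_of_all _ fun y => ?_)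
    dsimp only
    rw [← Finset.sum_mul, ← neg_mul]
    congr 1
    simp only [hpd2]
    rw [Finset.sum_add_distrib, ← Finset.sum_mul, ← Finset.mul_sum, ← norm_sub_sq_eq]
    simp only [Finset.sum_const, Finset.card_univ, Fintype.card_fin, nsmul_eq_mul]
    have h4 : ((√(δ + ‖y - x‖ ^ 2))⁻¹) ^ 2 * (δ + ‖y - x‖ ^ 2) = 1 := by
      rw [inv_pow, Real.sq_sqrt (hq y).le, inv_mul_cancel₀ (hq y).ne']
    push_cast
    linear_combination (3 * (√(δ + ‖y - x‖ ^ 2))⁻¹ ^ 3) * h4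
  rw [h3, Finset.sum_congr rfl fun i _ => h2 i, ← Finset.mul_sum]
  have h5 := Finset.sum_le_sum fun i (_ : i ∈ Finset.univ) => h1 i
  rw [Finset.sum_add_distrib, ← Finset.mul_sum _ (fun i => ‖h i‖ ^ 2)] at h5
  simp only [Finset.sum_const, Finset.card_univ, Fintype.card_fin, nsmul_eq_mul] at h5
  push_cast at h5
  linarith

/-- `integral_newton_kernel_le` with `δ = r²`, where the kernel `3 r² (r² + |y - x|²)^{-5/2}` is at least
`1 / (2 r³)` on the ball of radius `r`. -/
theorem integral_closedBall_norm_sq_le (hΩ : IsOpen Ω) (hΩb : Bornology.IsBounded Ω) (u : H10 N Ω)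
    {h : Fin 3 → L2 N Ω} (hu : ∀ i, HasWeakPartial Ω i (u.grad i) (h i)) (x : E3)
    {r : ℝ} (hr : 0 < r) :
    ∫ y in Metric.closedBall x r, Ω.indicator (fun y => ‖u.val y‖ ^ 2) y
      ≤ 2 * r ^ 3 * (12 * ‖u‖ ^ 2 + ∑ i, ‖h i‖ ^ 2) := by
  have key := integral_newton_kernel_le hΩ hΩb u hu x (δ := r ^ 2) (by positivity)
  have hq : ∀ y : E3, 0 < r ^ 2 + ‖y - x‖ ^ 2 := fun y => by positivity
  have hcont : Continuous fun y : E3 => 3 * r ^ 2 * ((√(r ^ 2 + ‖y - x‖ ^ 2))⁻¹) ^ 5 :=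
    continuous_const.mul ((((contDiff_add_norm_sq x _).continuous.sqrt).inv₀
      fun y => (Real.sqrt_ne_zero'.2 (hq y))).pow 5)
  have hle : ∫ y in Metric.closedBall x r, Ω.indicator (fun y => ‖u.val y‖ ^ 2) y
      ≤ 2 * r ^ 3 * ∫ y in Ω, 3 * r ^ 2 * ((√(r ^ 2 + ‖y - x‖ ^ 2))⁻¹) ^ 5 * ‖u.val y‖ ^ 2 := by
    rw [setIntegral_indicator hΩ.measurableSet, inter_comm,
      ← setIntegral_indicator Metric.isClosed_closedBall.measurableSet, ← integral_const_mul]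
    refine integral_mono ((L2.integrable_norm_sq _).indicator
      Metric.isClosed_closedBall.measurableSet)
      ((integrable_continuous_mul hΩ hΩb hcont (L2.integrable_norm_sq _)).const_mul _) fun y => ?_
    by_cases hy : y ∈ Metric.closedBall x r
    · rw [indicator_of_mem hy]
      rw [Metric.mem_closedBall, dist_eq_norm] at hy
      dsimp only
      rw [← mul_assoc]
      refine le_mul_of_one_le_left (sq_nonneg _) ?_
      set s := √(r ^ 2 + ‖y - x‖ ^ 2) with hs
      have hs0 : 0 < s := Real.sqrt_pos.2 (hq y)
      have hs2 : s ^ 2 ≤ 2 * r ^ 2 := by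
        rw [hs, Real.sq_sqrt (hq y).le]; nlinarith [norm_nonneg (y - x)]
      have hs5 : s ^ 5 ≤ 6 * r ^ 5 := by
        have h1 : s ≤ 3 / 2 * r := by
          refine le_of_sq_le_sq (hs2.trans ?_) (by positivity)
          nlinarith [sq_nonneg r]
        calc s ^ 5 = (s ^ 2) ^ 2 * s := by ring
          _ ≤ (2 * r ^ 2) ^ 2 * (3 / 2 * r) := by gcongr
          _ = 6 * r ^ 5 := by ring
      rw [inv_pow, ← mul_assoc, ← div_eq_mul_inv, one_le_div (by positivity)]
      linarith
    · rw [indicator_of_notMem hy]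
      positivity
  exact hle.trans (by gcongr)

/-- If `u ∈ H¹₀(Ω)` has pure second derivatives in `L²(Ω)`, then `u` is bounded. -/
theorem ae_norm_sq_le (hΩ : IsOpen Ω) (hΩb : Bornology.IsBounded Ω) (u : H10 N Ω)
    {h : Fin 3 → L2 N Ω} (hu : ∀ i, HasWeakPartial Ω i (u.grad i) (h i)) :
    ∀ᵐ x ∂(muO Ω), ‖u.val x‖ ^ 2 ≤ 12 * ‖u‖ ^ 2 + ∑ i, ‖h i‖ ^ 2 := by
  set S := 12 * ‖u‖ ^ 2 + ∑ i, ‖h i‖ ^ 2 with hS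
  have hS0 : 0 ≤ S := by positivity
  have hint : Integrable (Ω.indicator fun y => ‖u.val y‖ ^ 2) :=
    (integrable_indicator_iff hΩ.measurableSet).2 (L2.integrable_norm_sq u.val)
  have hae := IsUnifLocDoublingMeasure.ae_tendsto_average (μ := (volume : Measure E3))
    hint.locallyIntegrable 0
  rw [ae_restrict_iff' hΩ.measurableSet]
  filter_upwards [hae] with x hx hxΩ
  have hlim := hx (l := 𝓝[>] (0 : ℝ)) (fun _ => x) (fun r => r) tendsto_id
    (Eventually.of_forall fun r => by simp)
  rw [indicator_of_mem hxΩ] at hlim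
  refine le_of_tendsto hlim (eventually_mem_nhdsWithin.mono fun r hr => ?_)
  have hr : 0 < r := hr
  rw [setAverage_eq, smul_eq_mul]
  have hvol : volume.real (Metric.closedBall x r) = r ^ 3 * (Real.pi * 4 / 3) := by
    rw [Measure.real, Measure.addHaar_closedBall_eq_addHaar_ball,
      EuclideanSpace.volume_ball_fin_three, ENNReal.toReal_mul, ENNReal.toReal_pow,
      ENNReal.toReal_ofReal hr.le, ENNReal.toReal_ofReal (by positivity)]
  have hle := integral_closedBall_norm_sq_le hΩ hΩb u hu x hr
  rw [hvol, inv_mul_le_iff₀ (by positivity)]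
  refine hle.trans ?_
  -- the volume `4π r³ / 3` of the ball exceeds `2 r³`
  have : 2 * r ^ 3 ≤ r ^ 3 * (Real.pi * 4 / 3) := by
    have := Real.pi_gt_three
    have h3 : 0 < r ^ 3 := by positivity
    nlinarith
  exact mul_le_mul_of_nonneg_right this hS0

/-! ### Functions of the density -/

theorem density_eq (ψ : E3 → CN N) (x : E3) : density ψ x = ‖ψ x‖ ^ 2 :=
  (EuclideanSpace.norm_sq_eq _).symm

theorem measurable_density (f : L2 N Ω) : Measurable (density (f : E3 → CN N)) := by
  rw [funext (density_eq (f : E3 → CN N))]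
  exact (Lp.stronglyMeasurable f).norm.measurable.pow_const 2

theorem density_nonneg (ψ : E3 → CN N) (x : E3) : 0 ≤ density ψ x := by
  rw [density_eq]; positivity

theorem IsWeakDerivDensity.sub_eq {V g : ℝ → ℝ} (h : IsWeakDerivDensity V g) {a b : ℝ} (ha : 0 ≤ a)
    (hb : 0 ≤ b) : V b - V a = ∫ s in a..b, g s := by
  rw [(h.2 b hb).2, (h.2 a ha).2, ← intervalIntegral.integral_interval_sub_left
    (h.2 b hb).1 (h.2 a ha).1]
  ring

/-- `V` is continuous on `[0, ∞)`; its values on the negative half-line are arbitrary, so it is extended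
from `[0, ∞)` by a constant. -/
theorem IsWeakDerivDensity.continuous {V g : ℝ → ℝ} (h : IsWeakDerivDensity V g) :
    Continuous fun ρ => V (max ρ 0) := by
  have hi : ∀ b, IntervalIntegrable ((Ioi 0).indicator g) volume 0 b := fun b => by
    rcases le_total 0 b with hb | hb
    · refine (h.2 b hb).1.congr fun s hs => ?_
      rw [uIoc_of_le hb] at hs
      rw [indicator_of_mem (show s ∈ Ioi 0 from hs.1)]
    · refine (intervalIntegrable_const (c := (0 : ℝ))).congr fun s hs => ?_
      rw [uIoc_of_ge hb] at hs
      rw [indicator_of_notMem (show s ∉ Ioi 0 from not_lt.2 hs.2)]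
  have e : (fun ρ => V (max ρ 0)) = fun ρ => V 0 + ∫ s in (0 : ℝ)..(max ρ 0),
      (Ioi 0).indicator g s := by
    ext ρ
    have hρ : 0 ≤ max ρ 0 := le_max_right _ _
    rw [(h.2 _ hρ).2]
    congr 1
    refine intervalIntegral.integral_congr_ae (ae_of_all _ fun s hs => ?_)
    rw [uIoc_of_le hρ] at hs
    rw [indicator_of_mem (show s ∈ Ioi 0 from hs.1)]
  rw [e]
  exact continuous_const.add ((intervalIntegral.continuous_primitive
    (fun a b => (hi a).symm.trans (hi b)) 0).comp (continuous_id.max continuous_const))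

theorem IsWeakDerivDensity.measurable_comp_density {V g : ℝ → ℝ} (h : IsWeakDerivDensity V g)
    (f : L2 N Ω) : Measurable fun x => V (density (f : E3 → CN N) x) := by
  have := h.continuous.measurable.comp (measurable_density f)
  convert this using 2 with x
  rw [Function.comp_apply, max_eq_left (density_nonneg _ x)]

/-- If `|V| ≤ K` and `|ρ V'(ρ)| ≤ M`, then `z ↦ V(|z|²) z` is Lipschitz: for `|w| ≤ |z|` one has
`|V(|z|²) - V(|w|²)| ≤ M log (|z|² / |w|²) ≤ 2 M (|z| / |w| - 1)`. -/
theorem IsWeakDerivDensity.norm_smul_sub_smul_le {V g : ℝ → ℝ} (h : IsWeakDerivDensity V g)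
    {K M : ℝ} (hK : ∀ ρ, 0 ≤ ρ → |V ρ| ≤ K) (hM : ∀ ρ, 0 ≤ ρ → |g ρ * ρ| ≤ M) (z w : CN N) :
    ‖V (‖z‖ ^ 2) • z - V (‖w‖ ^ 2) • w‖ ≤ (K + 2 * M) * ‖z - w‖ := by
  wlog hwz : ‖w‖ ≤ ‖z‖ generalizing z w
  · rw [norm_sub_rev, norm_sub_rev z]
    exact this w z (le_of_not_ge hwz)
  have hM0 : 0 ≤ M := (abs_nonneg _).trans (hM 0 le_rfl)
  have hV : |V (‖z‖ ^ 2) - V (‖w‖ ^ 2)| * ‖w‖ ≤ 2 * M * ‖z - w‖ := by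
    rcases (norm_nonneg w).eq_or_lt with h0 | h0
    · rw [← h0, mul_zero]; positivity
    have hz0 : 0 < ‖z‖ := h0.trans_le hwz
    have hab : ‖w‖ ^ 2 ≤ ‖z‖ ^ 2 := by gcongr
    have hlog : |V (‖z‖ ^ 2) - V (‖w‖ ^ 2)| ≤ M * Real.log (‖z‖ ^ 2 / ‖w‖ ^ 2) := by
      rw [h.sub_eq (by positivity) (by positivity), ← integral_inv_of_pos (by positivity)
        (by positivity), ← intervalIntegral.integral_const_mul, ← Real.norm_eq_abs]
      refine intervalIntegral.norm_integral_le_of_norm_le hab (ae_of_all _ fun s hs => ?_) ?_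
      · have hs0 : 0 < s := lt_of_le_of_lt (by positivity) hs.1
        rw [← div_eq_mul_inv, le_div_iff₀ hs0, Real.norm_eq_abs]
        have := hM s hs0.le
        rwa [abs_mul, abs_of_pos hs0] at this
      · refine (intervalIntegral.intervalIntegrable_inv (fun s hs => ?_)
          continuousOn_id).const_mul M
        rw [uIcc_of_le hab] at hs
        exact (lt_of_lt_of_le (by positivity) hs.1).ne'
    have hlog2 : Real.log (‖z‖ ^ 2 / ‖w‖ ^ 2) ≤ 2 * (‖z‖ / ‖w‖ - 1) := by
      rw [← div_pow, Real.log_pow]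
      have := Real.log_le_sub_one_of_pos (div_pos hz0 h0)
      push_cast
      linarith
    calc |V (‖z‖ ^ 2) - V (‖w‖ ^ 2)| * ‖w‖ ≤ (M * (2 * (‖z‖ / ‖w‖ - 1))) * ‖w‖ := by
          gcongr; exact hlog.trans (by gcongr)
      _ = 2 * M * (‖z‖ - ‖w‖) := by field_simp
      _ ≤ 2 * M * ‖z - w‖ := by gcongr; exact norm_sub_norm_le z w
  have e : V (‖z‖ ^ 2) • z - V (‖w‖ ^ 2) • w
      = V (‖z‖ ^ 2) • (z - w) + (V (‖z‖ ^ 2) - V (‖w‖ ^ 2)) • w := by module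
  rw [e, add_mul]
  refine (norm_add_le _ _).trans (add_le_add ?_ ?_)
  · rw [norm_smul]
    gcongr
    exact hK _ (by positivity)
  · rwa [norm_smul]

/-- If `ρ V'(ρ)` grows at most linearly, then so does `V`. -/
theorem exists_abs_le_of_abs_deriv_mul_le {V g : ℝ → ℝ} (h : IsWeakDerivDensity V g) {M : ℝ}
    (hM : ∀ ρ, 0 ≤ ρ → |g ρ * ρ| ≤ M * (1 + ρ)) :
    ∃ C : ℝ, 0 ≤ C ∧ ∀ ρ, 0 ≤ ρ → |V ρ| ≤ C * (1 + ρ) := by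
  have hM0 : 0 ≤ M := by simpa using (abs_nonneg _).trans (hM 0 le_rfl)
  obtain ⟨C, hC⟩ := isCompact_Icc (a := (0 : ℝ)) (b := 1).exists_bound_of_continuousOn
    h.continuous.continuousOn
  have hC1 : ∀ ρ, 0 ≤ ρ → ρ ≤ 1 → |V ρ| ≤ C := fun ρ h0 h1 => by
    have := hC ρ ⟨h0, h1⟩
    rwa [max_eq_left h0] at this
  have hC0 : 0 ≤ C := (abs_nonneg _).trans (hC1 0 le_rfl zero_le_one)
  refine ⟨C + 2 * M, by positivity, fun ρ hρ => ?_⟩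
  rcases le_total ρ 1 with h1 | h1
  · refine (hC1 ρ hρ h1).trans ?_
    nlinarith
  · have hb : ‖∫ s in (1 : ℝ)..ρ, g s‖ ≤ 2 * M * |ρ - 1| := by
      refine intervalIntegral.norm_integral_le_of_norm_le_const fun s hs => ?_
      rw [uIoc_of_le h1] at hs
      have hs0 : 0 < s := zero_lt_one.trans hs.1
      have := hM s hs0.le
      rw [abs_mul, abs_of_pos hs0] at this
      rw [Real.norm_eq_abs]
      refine le_of_mul_le_mul_right (this.trans ?_) hs0
      nlinarith [hs.1]
    rw [← h.sub_eq zero_le_one hρ, Real.norm_eq_abs, abs_of_nonneg (by linarith : 0 ≤ ρ - 1)] at hb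
    have h2 := hC1 1 zero_le_one le_rfl
    have h3 : |V ρ| ≤ |V ρ - V 1| + |V 1| := by
      have := abs_add_le (V ρ - V 1) (V 1)
      rwa [sub_add_cancel] at this
    nlinarith

theorem IsWeakDerivDensity.add {V g V' g' : ℝ → ℝ} (h : IsWeakDerivDensity V g)
    (h' : IsWeakDerivDensity V' g') :
    IsWeakDerivDensity (fun ρ => V ρ + V' ρ) (fun ρ => g ρ + g' ρ) := by
  refine ⟨h.1.add h'.1, fun ρ hρ => ⟨(h.2 ρ hρ).1.add (h'.2 ρ hρ).1, ?_⟩⟩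
  rw [intervalIntegral.integral_add (h.2 ρ hρ).1 (h'.2 ρ hρ).1]
  have h1 := (h.2 ρ hρ).2
  have h2 := (h'.2 ρ hρ).2
  linarith

/-! ### Bounds for the scalar product and the Hartree potential -/

/-- The bound for `(f, w)` when `f` is dominated by three `L²` functions. -/
theorem norm_sp_le {f : E3 → CN N} {g₁ g₂ g₃ w : L2 N Ω} {A B C : ℝ}
    (h : ∀ᵐ x ∂(muO Ω), ‖f x‖ ≤ A * ‖g₁ x‖ + B * ‖g₂ x‖ + C * ‖g₃ x‖)
    (hA : 0 ≤ A) (hB : 0 ≤ B) (hC : 0 ≤ C) :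
    ‖sp Ω f w‖ ≤ (A * ‖g₁‖ + B * ‖g₂‖ + C * ‖g₃‖) * ‖w‖ := by
  have hi : ∀ g : L2 N Ω, Integrable (fun x => ‖g x‖ * ‖w x‖) (muO Ω) := fun g =>
    (memLp_norm g).integrable_mul (memLp_norm w)
  have hle : ∀ g : L2 N Ω, ∫ x in Ω, ‖g x‖ * ‖w x‖ ≤ ‖g‖ * ‖w‖ := fun g =>
    integral_mul_le_of_sq_le (memLp_norm g) (memLp_norm w) (norm_nonneg _) (norm_nonneg _)
      (L2.integral_norm_sq g).le (L2.integral_norm_sq w).le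
  have h1 : ‖sp Ω f w‖ ≤ ∫ x in Ω, (A * (‖g₁ x‖ * ‖w x‖) + B * (‖g₂ x‖ * ‖w x‖)
      + C * (‖g₃ x‖ * ‖w x‖)) := by
    refine norm_integral_le_of_norm_le ((((hi g₁).const_mul A).add ((hi g₂).const_mul B)).add
      ((hi g₃).const_mul C)) ?_
    filter_upwards [h] with x hx
    refine (norm_inner_le_norm _ _).trans ?_
    rw [mul_comm]
    refine (mul_le_mul_of_nonneg_right hx (norm_nonneg _)).trans (le_of_eq ?_)
    ring
  refine h1.trans ?_
  have h12 : Integrable (fun x => A * (‖g₁ x‖ * ‖w x‖) + B * (‖g₂ x‖ * ‖w x‖)) (muO Ω) :=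
    ((hi g₁).const_mul A).add ((hi g₂).const_mul B)
  rw [integral_add h12 ((hi g₃).const_mul C),
    integral_add ((hi g₁).const_mul A) ((hi g₂).const_mul B), integral_const_mul,
    integral_const_mul, integral_const_mul]
  have a1 := mul_le_mul_of_nonneg_left (hle g₁) hA
  have a2 := mul_le_mul_of_nonneg_left (hle g₂) hB
  have a3 := mul_le_mul_of_nonneg_left (hle g₃) hC
  linarith

theorem norm_sp_le_single {f : E3 → CN N} {g w : L2 N Ω} {A : ℝ}
    (h : ∀ᵐ x ∂(muO Ω), ‖f x‖ ≤ A * ‖g x‖) (hA : 0 ≤ A) : ‖sp Ω f w‖ ≤ A * ‖g‖ * ‖w‖ := by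
  have := norm_sp_le (w := w) (g₂ := 0) (g₃ := 0) (A := A) (B := 0) (C := 0)
    (h.mono fun x hx => by simpa using hx) hA le_rfl le_rfl
  simpa using this

theorem sp_sub {f₁ f₂ : E3 → CN N} (h₁ : MemLp f₁ 2 (muO Ω)) (h₂ : MemLp f₂ 2 (muO Ω))
    (w : L2 N Ω) : sp Ω f₁ w - sp Ω f₂ w = sp Ω (fun x => f₁ x - f₂ x) w := by
  simp only [sp, inner_sub_right]
  rw [integral_sub (integrable_inner_of_memLp (Lp.memLp w) h₁)
    (integrable_inner_of_memLp (Lp.memLp w) h₂)]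

/-- Multiplication by a bounded potential. -/
theorem norm_sp_potential_sub_le {m : E3 → ℝ} {C : ℝ} (hm : AEStronglyMeasurable m (muO Ω))
    (hC : ∀ᵐ x ∂(muO Ω), |m x| ≤ C) (hC0 : 0 ≤ C) (f g w : L2 N Ω) :
    ‖sp Ω (fun x => m x • f x) w - sp Ω (fun x => m x • g x) w‖ ≤ C * ‖f - g‖ * ‖w‖ := by
  have hL : ∀ f : L2 N Ω, MemLp (fun x => m x • f x) 2 (muO Ω) := fun f => by
    refine (Lp.memLp f).of_le_mul (c := C) (hm.smul (Lp.aestronglyMeasurable f)) ?_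
    filter_upwards [hC] with x hx
    rw [norm_smul]
    gcongr
    exact hx
  rw [sp_sub (hL f) (hL g)]
  refine norm_sp_le_single ?_ hC0
  filter_upwards [hC, Lp.coeFn_sub f g] with x h1 h2
  rw [h2, Pi.sub_apply, ← smul_sub, norm_smul]
  gcongr
  exact h1

theorem stronglyMeasurable_hartree {r : E3 → ℝ} (hr : Measurable r) :
    StronglyMeasurable (hartree Ω r) := by
  refine StronglyMeasurable.integral_prod_right (f := fun x y : E3 => r y / ‖x - y‖) ?_
  have h1 : Measurable fun p : E3 × E3 => ‖p.1 - p.2‖ := by fun_prop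
  exact ((hr.comp measurable_snd).div h1).stronglyMeasurable

theorem integrable_hartree (hΩ : IsOpen Ω) (hΩb : Bornology.IsBounded Ω)
    {r : E3 → ℝ} (hr : Measurable r) {f : L2 N Ω} {w : H10 N Ω} {A : ℝ}
    (h : ∀ᵐ y ∂(muO Ω), |r y| ≤ A * (‖f y‖ * ‖w.val y‖)) (x : E3) :
    Integrable (fun y => r y / ‖x - y‖) (muO Ω) := by
  have hm : Measurable fun y : E3 => ‖x - y‖ := by fun_prop
  refine ((coulomb_bound hΩ hΩb f w x).1.const_mul A).mono'
    (hr.div hm).aestronglyMeasurable ?_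
  filter_upwards [h] with y hy
  rw [norm_div, norm_norm, Real.norm_eq_abs, ← mul_div_assoc, ← mul_div_assoc]
  gcongr

/-- The Hartree potential of `r` is bounded if `r` is dominated by a product of an `L²` and an `H¹₀`
function. -/
theorem abs_hartree_le (hΩ : IsOpen Ω) (hΩb : Bornology.IsBounded Ω)
    {r : E3 → ℝ} {f : L2 N Ω} {w : H10 N Ω} {A : ℝ} (hA : 0 ≤ A)
    (h : ∀ᵐ y ∂(muO Ω), |r y| ≤ A * (‖f y‖ * ‖w.val y‖)) (x : E3) :
    |hartree Ω r x| ≤ A * (2 * ‖f‖ * ‖w‖) := by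
  obtain ⟨h1, h2⟩ := coulomb_bound hΩ hΩb f w x
  change ‖∫ y in Ω, r y / ‖x - y‖‖ ≤ _
  refine (norm_integral_le_of_norm_le (h1.const_mul A) ?_).trans ?_
  · filter_upwards [h] with y hy
    rw [norm_div, norm_norm, Real.norm_eq_abs, ← mul_div_assoc, ← mul_div_assoc]
    gcongr
  · rw [integral_const_mul]
    gcongr

theorem abs_hartree_density_le (hΩ : IsOpen Ω) (hΩb : Bornology.IsBounded Ω)
    (ψ : H10 N Ω) (x : E3) :
    |hartree Ω (density ψ.val) x| ≤ 2 * ‖ψ‖ ^ 2 := by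
  have := abs_hartree_le hΩ hΩb (r := density ψ.val) (f := ψ.val) (w := ψ) zero_le_one
    (ae_of_all _ fun y => by rw [density_eq, abs_of_nonneg (by positivity)]; ring_nf; rfl) x
  refine this.trans ?_
  have := ψ.norm_val_le
  nlinarith [norm_nonneg ψ]

theorem integrable_hartree_density (hΩ : IsOpen Ω) (hΩb : Bornology.IsBounded Ω)
    (ψ : H10 N Ω) (x : E3) :
    Integrable (fun y => density ψ.val y / ‖x - y‖) (muO Ω) :=
  integrable_hartree hΩ hΩb (measurable_density ψ.val) (f := ψ.val) (w := ψ) (A := 1)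
    (ae_of_all _ fun y => by rw [density_eq, abs_of_nonneg (by positivity)]; ring_nf; rfl) x

/-- The Hartree potential is locally Lipschitz in the wave function, from `L²` to `L^∞`, since
`|ρ_ψ - ρ_υ| ≤ |ψ - υ| (|ψ| + |υ|)`. -/
theorem abs_hartree_density_sub_le (hΩ : IsOpen Ω) (hΩb : Bornology.IsBounded Ω)
    (ψ υ : H10 N Ω) (x : E3) :
    |hartree Ω (density ψ.val) x - hartree Ω (density υ.val) x|
      ≤ 2 * ‖ψ.val - υ.val‖ * (‖ψ‖ + ‖υ‖) := by
  have e : hartree Ω (density ψ.val) x - hartree Ω (density υ.val) x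
      = ∫ y in Ω, (density ψ.val y / ‖x - y‖ - density υ.val y / ‖x - y‖) :=
    (integral_sub (integrable_hartree_density hΩ hΩb ψ x)
      (integrable_hartree_density hΩ hΩb υ x)).symm
  obtain ⟨h1, h2⟩ := coulomb_bound hΩ hΩb (ψ.val - υ.val) ψ x
  obtain ⟨h3, h4⟩ := coulomb_bound hΩ hΩb (ψ.val - υ.val) υ x
  rw [e, ← Real.norm_eq_abs]
  refine (norm_integral_le_of_norm_le (h1.add h3) ?_).trans ?_
  · filter_upwards [Lp.coeFn_sub ψ.val υ.val] with y hy
    rw [Pi.add_apply, hy, Pi.sub_apply, ← sub_div, norm_div, norm_norm, ← mul_div_assoc,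
      ← mul_div_assoc, ← add_div, density_eq, density_eq, Real.norm_eq_abs, ← mul_add]
    gcongr
    rw [sq_sub_sq, abs_mul, abs_of_nonneg (by positivity : 0 ≤ ‖ψ.val y‖ + ‖υ.val y‖), mul_comm]
    gcongr
    exact abs_norm_sub_norm_le _ _
  · rw [integral_add' h1 h3]
    linarith

/-! ### Lipschitz bounds for the lower order terms -/

theorem exists_ae_abs_le {f : E3 → ℝ} (hf : MemLp f ∞ (muO Ω)) :
    ∃ C : ℝ, 0 ≤ C ∧ ∀ᵐ x ∂(muO Ω), |f x| ≤ C := by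
  refine ⟨(eLpNorm f ∞ (muO Ω)).toReal, ENNReal.toReal_nonneg, ?_⟩
  rw [eLpNorm_exponent_top]
  have hfin : eLpNormEssSup f (muO Ω) ≠ ⊤ := by
    rw [← eLpNorm_exponent_top]; exact hf.2.ne
  filter_upwards [ae_le_eLpNormEssSup (f := f) (μ := muO Ω)] with x hx
  have := ENNReal.toReal_mono hfin hx
  rwa [toReal_enorm, Real.norm_eq_abs] at this

theorem Data.norm_sp_Vext_sub_le (P : Data N Ω T) (hV0 : MemLp P.V0 ∞ (muO Ω))
    (hVu : MemLp P.Vu ∞ (muO Ω)) :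
    ∃ C : ℝ, 0 ≤ C ∧ ∀ (t : ℝ) (f g w : L2 N Ω),
      ‖sp Ω (fun x => P.Vext t x • f x) w - sp Ω (fun x => P.Vext t x • g x) w‖
        ≤ C * (1 + |P.u t|) * ‖f - g‖ * ‖w‖ := by
  obtain ⟨C₀, hC₀, h₀⟩ := exists_ae_abs_le hV0
  obtain ⟨C₁, hC₁, h₁⟩ := exists_ae_abs_le hVu
  refine ⟨C₀ + C₁, by positivity, fun t f g w => ?_⟩
  refine norm_sp_potential_sub_le (hV0.1.add (hVu.1.mul_const _)) ?_ (by positivity) f g w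
  filter_upwards [h₀, h₁] with x h2 h3
  refine (abs_add_le _ _).trans ?_
  rw [abs_mul]
  have h4 := abs_nonneg (P.u t)
  have h5 := mul_le_mul_of_nonneg_right h3 h4
  nlinarith

/-- The Lipschitz estimate for `ψ ↦ V(ψ) ψ`, from the splitting
`V_H(ρ_ψ) ψ - V_H(ρ_υ) υ = V_H(ρ_ψ) (ψ - υ) + V_H(ρ_ψ - ρ_υ) υ` of the Hartree term. -/
theorem Data.norm_sp_V_sub_le (P : Data N Ω T) (hΩ : IsOpen Ω) (hΩb : Bornology.IsBounded Ω)
    (hVx : IsWeakDerivDensity P.Vx P.dVx) (hVc : IsWeakDerivDensity P.Vc P.dVc) {K M : ℝ}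
    (hK : ∀ ρ : ℝ, 0 ≤ ρ → |P.Vc ρ| ≤ K) (hM : ∀ ρ : ℝ, 0 ≤ ρ → |P.dVc ρ * ρ| ≤ M) {L : ℝ≥0}
    (ψ υ : H10 N Ω) (w : L2 N Ω)
    (hψ : MemLp (fun x => P.V ψ.val x • ψ.val x) 2 (muO Ω))
    (hυ : MemLp (fun x => P.V υ.val x • υ.val x) 2 (muO Ω))
    (hL : eLpNorm (fun x => P.Vx (density ψ.val x) • ψ.val x
      - P.Vx (density υ.val x) • υ.val x) 2 (muO Ω)
        ≤ L * eLpNorm (fun x => ψ.val x - υ.val x) 2 (muO Ω)) :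
    ‖sp Ω (fun x => P.V ψ.val x • ψ.val x) w - sp Ω (fun x => P.V υ.val x • υ.val x) w‖
      ≤ (3 * (‖ψ‖ ^ 2 + ‖υ‖ ^ 2) + (L + (K + 2 * M))) * ‖ψ.val - υ.val‖ * ‖w‖ := by
  have hK0 : 0 ≤ K := (abs_nonneg _).trans (hK 0 le_rfl)
  have hM0 : 0 ≤ M := (abs_nonneg _).trans (hM 0 le_rfl)
  have hsub : (fun x => ψ.val x - υ.val x) =ᵐ[muO Ω] (ψ.val - υ.val : L2 N Ω) :=
    (Lp.coeFn_sub ψ.val υ.val).symm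
  have hLfin : (L : ℝ≥0∞) * eLpNorm (fun x => ψ.val x - υ.val x) 2 (muO Ω) < ⊤ := by
    rw [eLpNorm_congr_ae hsub]
    exact ENNReal.mul_lt_top ENNReal.coe_lt_top (Lp.eLpNorm_lt_top _)
  have hG : MemLp (fun x => P.Vx (density ψ.val x) • ψ.val x
      - P.Vx (density υ.val x) • υ.val x) 2 (muO Ω) :=
    ⟨((hVx.measurable_comp_density ψ.val).aestronglyMeasurable.smul
      (Lp.aestronglyMeasurable _)).sub
      ((hVx.measurable_comp_density υ.val).aestronglyMeasurable.smul
      (Lp.aestronglyMeasurable _)), hL.trans_lt hLfin⟩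
  have hGn : ‖hG.toLp‖ ≤ L * ‖ψ.val - υ.val‖ := by
    rw [Lp.norm_toLp]
    refine (ENNReal.toReal_mono hLfin.ne hL).trans (le_of_eq ?_)
    rw [ENNReal.toReal_mul, ENNReal.coe_toReal, eLpNorm_congr_ae hsub, Lp.norm_def]
  rw [sp_sub hψ hυ]
  have hB0 : 0 ≤ 2 * ‖ψ.val - υ.val‖ * (‖ψ‖ + ‖υ‖) := by positivity
  refine (norm_sp_le (g₁ := ψ.val - υ.val) (g₂ := υ.val) (g₃ := hG.toLp)
    (A := 2 * ‖ψ‖ ^ 2 + (K + 2 * M)) (B := 2 * ‖ψ.val - υ.val‖ * (‖ψ‖ + ‖υ‖)) (C := 1) ?_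
    (by positivity) hB0 zero_le_one).trans ?_
  · filter_upwards [Lp.coeFn_sub ψ.val υ.val, hG.coeFn_toLp] with x h1 h2
    rw [h1, h2, Pi.sub_apply]
    have hH := abs_hartree_density_le hΩ hΩb ψ x
    have hHd := abs_hartree_density_sub_le hΩ hΩb ψ υ x
    have hc := hVc.norm_smul_sub_smul_le hK hM (ψ.val x) (υ.val x)
    rw [← density_eq, ← density_eq] at hc
    simp only [Data.V]
    generalize hartree Ω (density ψ.val) x = H₁ at hH hHd
    generalize hartree Ω (density υ.val) x = H₂ at hHd
    have e : (H₁ + P.Vx (density ψ.val x) + P.Vc (density ψ.val x)) • ψ.val x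
          - (H₂ + P.Vx (density υ.val x) + P.Vc (density υ.val x)) • υ.val x
        = (H₁ • (ψ.val x - υ.val x) + (P.Vc (density ψ.val x) • ψ.val x
            - P.Vc (density υ.val x) • υ.val x)) + (H₁ - H₂) • υ.val x
          + (P.Vx (density ψ.val x) • ψ.val x - P.Vx (density υ.val x) • υ.val x) := by module
    rw [e, one_mul, add_mul]
    refine (norm_add_le _ _).trans (add_le_add ((norm_add_le _ _).trans (add_le_add
      ((norm_add_le _ _).trans (add_le_add ?_ hc)) ?_)) le_rfl)
    · rw [norm_smul]; gcongr; exact hH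
    · rw [norm_smul]; gcongr; exact hHd
  · refine mul_le_mul_of_nonneg_right ?_ (norm_nonneg _)
    have h1 : 2 * ‖ψ.val - υ.val‖ * (‖ψ‖ + ‖υ‖) * ‖υ.val‖
        ≤ 2 * ‖ψ.val - υ.val‖ * (‖ψ‖ + ‖υ‖) * ‖υ‖ :=
      mul_le_mul_of_nonneg_left υ.norm_val_le hB0
    have h2 : 2 * (‖ψ‖ + ‖υ‖) * ‖υ‖ ≤ ‖ψ‖ ^ 2 + 3 * ‖υ‖ ^ 2 := by
      nlinarith [sq_nonneg (‖ψ‖ - ‖υ‖)]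
    have h3 := mul_le_mul_of_nonneg_right h2 (norm_nonneg (ψ.val - υ.val))
    linarith

theorem abs_reProd_le (f g : E3 → CN N) (x : E3) : |reProd f g x| ≤ ‖g x‖ * ‖f x‖ :=
  (Complex.abs_re_le_norm _).trans (norm_inner_le_norm _ _)

theorem measurable_reProd (f g : L2 N Ω) : Measurable (reProd (f : E3 → CN N) g) :=
  Complex.measurable_re.comp
    ((Lp.stronglyMeasurable g).inner (Lp.stronglyMeasurable f)).measurable

/-- The Hartree part of `D` is bounded on `L²`, with a constant integrable in time. -/
theorem Data.norm_DH_sub_le (P : Data N Ω T) (hΩ : IsOpen Ω) (hΩb : Bornology.IsBounded Ω) (t : ℝ)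
    (f g w : L2 N Ω) :
    ‖P.DH t f w - P.DH t g w‖ ≤ 4 * ‖P.Λ t‖ ^ 2 * ‖f - g‖ * ‖w‖ := by
  simp only [Data.DH]
  set l := P.Λ t
  have hr : ∀ f : L2 N Ω, Measurable fun y => 2 * reProd f l.val y := fun f =>
    (measurable_reProd f l.val).const_mul 2
  have hb : ∀ (f : L2 N Ω) (y : E3), |2 * reProd f l.val y| ≤ 2 * (‖f y‖ * ‖l.val y‖) :=
    fun f y => by
      rw [abs_mul, abs_two, mul_comm ‖f y‖]
      gcongr
      exact abs_reProd_le _ _ _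
  have hmem : ∀ f : L2 N Ω,
      MemLp (fun x => hartree Ω (fun y => 2 * reProd f l.val y) x • l.val x) 2 (muO Ω) := by
    intro f
    refine (Lp.memLp l.val).of_le_mul (c := 2 * (2 * ‖f‖ * ‖l‖))
      ((stronglyMeasurable_hartree (hr f)).aestronglyMeasurable.smul (Lp.aestronglyMeasurable _))
      (ae_of_all _ fun x => ?_)
    rw [norm_smul]
    gcongr
    exact abs_hartree_le hΩ hΩb zero_le_two (ae_of_all _ (hb f)) x
  rw [sp_sub (hmem f) (hmem g)]
  refine (norm_sp_le_single (g := l.val) (A := 2 * (2 * ‖f - g‖ * ‖l‖)) ?_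
    (by positivity)).trans ?_
  · refine ae_of_all _ fun x => ?_
    rw [← sub_smul, norm_smul]
    gcongr
    have e : hartree Ω (fun y => 2 * reProd f l.val y) x
        - hartree Ω (fun y => 2 * reProd g l.val y) x
        = hartree Ω (fun y => 2 * reProd (f - g : L2 N Ω) l.val y) x := by
      simp only [hartree]
      rw [← integral_sub
        (integrable_hartree hΩ hΩb (hr f) (f := f) (w := l) (ae_of_all _ (hb f)) x)
        (integrable_hartree hΩ hΩb (hr g) (f := g) (w := l) (ae_of_all _ (hb g)) x)]
      refine integral_congr_ae ?_
      filter_upwards [Lp.coeFn_sub f g] with y hy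
      simp only [reProd]
      rw [hy, Pi.sub_apply, inner_sub_right, Complex.sub_re]
      ring
    rw [e]
    exact abs_hartree_le hΩ hΩb zero_le_two (ae_of_all _ (hb _)) x
  · have := l.norm_val_le
    have h2 : 2 * (2 * ‖f - g‖ * ‖l‖) * ‖l.val‖ ≤ 2 * (2 * ‖f - g‖ * ‖l‖) * ‖l‖ := by gcongr
    refine mul_le_mul_of_nonneg_right (h2.trans (le_of_eq ?_)) (norm_nonneg _)
    ring

/-- The exchange-correlation part of `D` is bounded on `L²`: its coefficient is at most
`2 |(V_x' + V_c')(ρ_Λ)| ρ_Λ ≤ 2 M (1 + ρ_Λ)`. -/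
theorem Data.norm_Dxc_sub_le (P : Data N Ω T) (hVx : IsWeakDerivDensity P.Vx P.dVx)
    (hVc : IsWeakDerivDensity P.Vc P.dVc) {M S : ℝ}
    (hM : ∀ ρ : ℝ, 0 ≤ ρ → |(P.dVx ρ + P.dVc ρ) * ρ| ≤ M * (1 + ρ)) (hM0 : 0 ≤ M) (hS0 : 0 ≤ S)
    (t : ℝ) (hS : ∀ᵐ x ∂(muO Ω), ‖(P.Λ t).val x‖ ^ 2 ≤ S) (f g w : L2 N Ω) :
    ‖P.Dxc t f w - P.Dxc t g w‖ ≤ 2 * (M * (1 + S)) * ‖f - g‖ * ‖w‖ := by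
  simp only [Data.Dxc]
  set l := P.Λ t
  have hb : ∀ᵐ x ∂(muO Ω), ∀ z : CN N, ‖(2 * (P.dVx (density l.val x) + P.dVc (density l.val x))
      * (inner ℂ (l.val x) z).re) • l.val x‖ ≤ 2 * (M * (1 + S)) * ‖z‖ := by
    filter_upwards [hS] with x hx z
    have h1 := hM _ (density_nonneg (l.val : E3 → CN N) x)
    have h2 : |(inner ℂ (l.val x) z).re| ≤ ‖l.val x‖ * ‖z‖ :=
      (Complex.abs_re_le_norm _).trans (norm_inner_le_norm _ _)
    rw [abs_mul, abs_of_nonneg (density_nonneg _ _)] at h1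
    rw [norm_smul, Real.norm_eq_abs, abs_mul, abs_mul, abs_two]
    calc _ ≤ 2 * |P.dVx (density l.val x) + P.dVc (density l.val x)| * (‖l.val x‖ * ‖z‖)
          * ‖l.val x‖ := by gcongr
      _ = 2 * (|P.dVx (density l.val x) + P.dVc (density l.val x)| * density l.val x) * ‖z‖ := by
          rw [density_eq]; ring
      _ ≤ 2 * (M * (1 + density l.val x)) * ‖z‖ := by gcongr
      _ ≤ 2 * (M * (1 + S)) * ‖z‖ := by rw [density_eq]; gcongr
  have hmem : ∀ f : L2 N Ω, MemLp (fun x => (2 * (P.dVx (density l.val x)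
      + P.dVc (density l.val x)) * reProd f l.val x) • l.val x) 2 (muO Ω) := by
    intro f
    refine (Lp.memLp f).of_le_mul (c := 2 * (M * (1 + S))) ?_ (hb.mono fun x hx => hx _)
    have h1 := (((hVx.1.comp (measurable_density l.val)).add
      (hVc.1.comp (measurable_density l.val))).const_mul 2).mul (measurable_reProd f l.val)
    exact h1.aestronglyMeasurable.smul (Lp.aestronglyMeasurable l.val)
  rw [sp_sub (hmem f) (hmem g)]
  refine norm_sp_le_single ?_ (by positivity)
  filter_upwards [hb, Lp.coeFn_sub f g] with x h1 h2
  have h3 := h1 ((f - g : L2 N Ω) x)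
  rw [h2, Pi.sub_apply, inner_sub_right, Complex.sub_re, mul_sub, sub_smul] at h3
  rw [h2, Pi.sub_apply]
  exact h3

/-- Multiplication by the potential `V(Λ)` is bounded on `L²` if `Λ` is a bounded function. -/
theorem Data.norm_sp_VΛ_sub_le (P : Data N Ω T) (hΩ : IsOpen Ω) (hΩb : Bornology.IsBounded Ω)
    (hVx : IsWeakDerivDensity P.Vx P.dVx) (hVc : IsWeakDerivDensity P.Vc P.dVc) {C S : ℝ}
    (hC : ∀ ρ : ℝ, 0 ≤ ρ → |P.Vx ρ + P.Vc ρ| ≤ C * (1 + ρ)) (hC0 : 0 ≤ C) (hS0 : 0 ≤ S)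
    (l : H10 N Ω) (hS : ∀ᵐ x ∂(muO Ω), ‖l.val x‖ ^ 2 ≤ S) (f g w : L2 N Ω) :
    ‖sp Ω (fun x => P.V l.val x • f x) w - sp Ω (fun x => P.V l.val x • g x) w‖
      ≤ (2 * ‖l‖ ^ 2 + C * (1 + S)) * ‖f - g‖ * ‖w‖ := by
  refine norm_sp_potential_sub_le ?_ ?_ (by positivity) f g w
  · exact (((stronglyMeasurable_hartree (measurable_density l.val)).measurable.add
      (hVx.measurable_comp_density l.val)).add
      (hVc.measurable_comp_density l.val)).aestronglyMeasurable
  · filter_upwards [hS] with x hx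
    rw [Data.V, add_assoc]
    refine (abs_add_le _ _).trans (add_le_add (abs_hartree_density_le hΩ hΩb l x) ?_)
    refine (hC _ (density_nonneg _ _)).trans ?_
    rw [density_eq]
    gcongr

/-! ### The difference of two weak solutions -/

theorem integrable_apply {V : Type*} [NormedAddCommGroup V] [InnerProductSpace ℂ V]
    (φ' : Lp (V →L⋆[ℂ] ℂ) 2 (muT T)) (w : V) : Integrable (fun t => φ' t w) (muT T) := by
  have h : Integrable φ' (muT T) := (Lp.memLp φ').integrable one_le_two
  refine (h.norm.mul_const ‖w‖).mono' ?_ (ae_of_all _ fun t => (φ' t).le_opNorm w)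
  have hc : Continuous fun ℓ : V →L⋆[ℂ] ℂ => ℓ w := by fun_prop
  exact hc.comp_aestronglyMeasurable h.1

theorem integrable_inner_val (Ψ : X N Ω T) (f : L2 N Ω) :
    Integrable (fun t => inner ℂ f (Ψ t).val) (muT T) := by
  have h : MemLp Ψ 2 (muT T) := Lp.memLp Ψ
  have hm : AEStronglyMeasurable (fun t => (Ψ t).val) (muT T) :=
    H10.continuous_val.comp_aestronglyMeasurable h.1
  refine ((h.integrable one_le_two).norm.const_mul ‖f‖).mono'
    (aestronglyMeasurable_const.inner hm) (ae_of_all _ fun t => ?_)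
  refine (norm_inner_le_norm _ _).trans ?_
  gcongr
  exact H10.norm_val_le _

theorem IsTimeDeriv.sub {Ψ Υ : X N Ω T} {Ψ' Υ' : Xstar N Ω T} (h₁ : IsTimeDeriv Ψ Ψ')
    (h₂ : IsTimeDeriv Υ Υ') : IsTimeDeriv (Ψ - Υ) (Ψ' - Υ') := by
  intro η hη Φ
  have hb : ∀ ξ : ℝ → ℝ, Continuous ξ → HasCompactSupport ξ → ∀ f : ℝ → ℂ,
      Integrable f (muT T) → Integrable (fun t => (ξ t : ℂ) * f t) (muT T) := fun ξ h1 h2 f hf => by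
    obtain ⟨C, hC⟩ := h2.exists_bound_of_continuous h1
    exact hf.bdd_mul (c := C) (Complex.continuous_ofReal.comp h1).aestronglyMeasurable
      (ae_of_all _ fun t => by simpa using hC t)
  have hη' : Continuous (deriv η) := hη.1.continuous_deriv (by simp)
  have e1 : ∫ t in Ioo 0 T, ((deriv η t : ℝ) : ℂ) * sp Ω ((Ψ - Υ) t).val Φ.val
      = ∫ t in Ioo 0 T, (((deriv η t : ℝ) : ℂ) * sp Ω (Ψ t).val Φ.val
        - ((deriv η t : ℝ) : ℂ) * sp Ω (Υ t).val Φ.val) := by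
    refine integral_congr_ae ?_
    filter_upwards [Lp.coeFn_sub Ψ Υ] with t ht
    rw [ht, Pi.sub_apply, H10.val_sub, sp_eq_inner, sp_eq_inner, sp_eq_inner, inner_sub_right,
      mul_sub]
  have e2 : ∫ t in Ioo 0 T, (η t : ℂ) * (Ψ' - Υ') t Φ
      = ∫ t in Ioo 0 T, ((η t : ℂ) * Ψ' t Φ - (η t : ℂ) * Υ' t Φ) := by
    refine integral_congr_ae ?_
    filter_upwards [Lp.coeFn_sub Ψ' Υ'] with t ht
    rw [ht, Pi.sub_apply, ← mul_sub]
    rfl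
  have i₁ (Ξ : X N Ω T) :
      Integrable (fun t => ((deriv η t : ℝ) : ℂ) * sp Ω (Ξ t).val Φ.val) (muT T) :=
    hb _ hη' hη.2.1.deriv _ (integrable_inner_val Ξ Φ.val)
  have i₂ (Ξ' : Xstar N Ω T) : Integrable (fun t => (η t : ℂ) * Ξ' t Φ) (muT T) :=
    hb _ hη.1.continuous hη.2.1 _ (integrable_apply (V := H10 N Ω) Ξ' Φ)
  rw [e1, e2, integral_sub (i₁ Ψ) (i₁ Υ), integral_sub (i₂ Ψ') (i₂ Υ'), h₁ η hη Φ, h₂ η hη Φ]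
  ring

theorem HasInitialValue.sub {Ψ Υ : X N Ω T} {f g : L2 N Ω} (h₁ : HasInitialValue Ψ f)
    (h₂ : HasInitialValue Υ g) : HasInitialValue (Ψ - Υ) (f - g) := by
  obtain ⟨c₁, hc₁, he₁, h0₁⟩ := h₁
  obtain ⟨c₂, hc₂, he₂, h0₂⟩ := h₂
  refine ⟨fun t => c₁ t - c₂ t, hc₁.sub hc₂, ?_, by simp only [h0₁, h0₂]⟩
  filter_upwards [he₁, he₂, Lp.coeFn_sub Ψ Υ] with t h1 h2 h3
  rw [h1, h2, h3]
  rfl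

theorem integrable_norm_sq_coe {E : Type*} [NormedAddCommGroup E] (f : Lp E 2 (muT T)) :
    Integrable (fun t => ‖f t‖ ^ 2) (muT T) :=
  (Lp.memLp f).integrable_norm_pow two_ne_zero

/-- Two weak solutions agree if, for almost every `t`, the lower order terms of their equations
differ by at most `k(t) ‖Ψ(t) - Υ(t)‖` in `L²`, with an integrable `k`. -/
theorem Data.eq_of_isWeakSolution (P : Data N Ω T) (hΩ : IsOpen Ω) (hT : 0 < T) {Ψ Υ : X N Ω T}
    (hΨ : P.IsWeakSolution Ψ) (hΥ : P.IsWeakSolution Υ) {k : ℝ → ℝ} (hk : Integrable k (muT T))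
    (hk0 : ∀ t, 0 ≤ k t)
    (h : ∀ᵐ t ∂(muT T),
      MemLp (fun x => (P.α * P.V (Ψ t).val x) • (Ψ t).val x) 2 (muO Ω) →
      MemLp (fun x => (P.α * P.V (Υ t).val x) • (Υ t).val x) 2 (muO Ω) → ∀ w : H10 N Ω,
      ‖(P.B t (Ψ t) w + (P.α : ℂ) * sp Ω (fun x => P.V (Ψ t).val x • (Ψ t).val x) w.val
            - ∑ i, sp Ω ((Ψ t).grad i) (w.grad i))
          - (P.B t (Υ t) w + (P.α : ℂ) * sp Ω (fun x => P.V (Υ t).val x • (Υ t).val x) w.val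
            - ∑ i, sp Ω ((Υ t).grad i) (w.grad i))‖
        ≤ k t * ‖(Ψ t).val - (Υ t).val‖ * ‖w.val‖) : Ψ = Υ := by
  obtain ⟨⟨Ψ', hd₁, he₁⟩, hi₁⟩ := hΨ
  obtain ⟨⟨Υ', hd₂, he₂⟩, hi₂⟩ := hΥ
  have hi := hi₁.sub hi₂
  rw [sub_self] at hi
  refine sub_eq_zero.1 (eq_zero_of_isTimeDeriv hΩ hT (hd₁.sub hd₂) hi hk (ae_of_all _ hk0) ?_)
  filter_upwards [h, he₁, he₂, Lp.coeFn_sub Ψ Υ, Lp.coeFn_sub Ψ' Υ'] with t h1 h2 h3 h4 h5 w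
  have h6 := h1 h2.1 h3.1 w
  have e1 : (Ψ' - Υ') t w = Ψ' t w - Υ' t w := by rw [h5]; rfl
  have e2 : ∀ i, sp Ω (((Ψ - Υ) t).grad i) (w.grad i)
      = sp Ω ((Ψ t).grad i) (w.grad i) - sp Ω ((Υ t).grad i) (w.grad i) := fun i => by
    rw [h4, Pi.sub_apply, H10.grad_sub, sp_eq_inner, sp_eq_inner, sp_eq_inner, inner_sub_right]
  have e3 : ((Ψ - Υ) t).val = (Ψ t).val - (Υ t).val := by rw [h4]; rfl
  rw [e1, e3, mul_sub, h2.2 w, h3.2 w, Finset.sum_congr rfl fun i _ => e2 i,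
    Finset.sum_sub_distrib]
  refine le_trans (le_of_eq ?_) h6
  congr 1
  ring

end TDKS

open TDKS

theorem mainTheorem2
    (N : ℕ) (Ω : Set TDKS.E3) (hΩ : IsOpen Ω) (hΩb : Bornology.IsBounded Ω)
    (T : ℝ) (hT : 0 < T) (P : TDKS.Data N Ω T)
    -- the two cases: the forward equation (`α = 1`) and the adjoint equation (`α = 0`)
    (hα : P.α = 0 ∨ P.α = 1)
    -- bounded external potentials, control in `H¹(0,T)`
    (hV0 : MemLp P.V0 ∞ (TDKS.muO Ω)) (hVu : MemLp P.Vu ∞ (TDKS.muO Ω))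
    (hu : TDKS.MemH1Time T P.u)
    -- `V_x`, `V_c` are weakly differentiable in `ρ`, and `V_c` is bounded
    (hVx : TDKS.IsWeakDerivDensity P.Vx P.dVx) (hVc : TDKS.IsWeakDerivDensity P.Vc P.dVc)
    (hVcb : ∃ K : ℝ, ∀ ρ : ℝ, 0 ≤ ρ → |P.Vc ρ| ≤ K)
    -- forward equation: `ρ V_c'(ρ)` is bounded
    (hdVc : P.α = 1 → ∃ M : ℝ, ∀ ρ : ℝ, 0 ≤ ρ → |P.dVc ρ * ρ| ≤ M)
    -- forward equation: `V_x(Ψ)Ψ` is Lipschitz continuous on weak solutions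
    (hVxLip : P.α = 1 → ∃ L : ℝ≥0, ∀ Ψ Υ : TDKS.X N Ω T,
      P.IsWeakSolution Ψ → P.IsWeakSolution Υ → ∀ᵐ t ∂(TDKS.muT T),
        eLpNorm (fun x => P.Vx (TDKS.density (Ψ t).val x) • (Ψ t).val x
            - P.Vx (TDKS.density (Υ t).val x) • (Υ t).val x) 2 (TDKS.muO Ω)
          ≤ L * eLpNorm (fun x => (Ψ t).val x - (Υ t).val x) 2 (TDKS.muO Ω))
    -- adjoint equation: `ρ V_xc'(ρ)` grows at most linearly, and `Λ ∈ L²(0,T; H²)`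
    (hdVxc : P.α = 0 → ∃ M : ℝ, ∀ ρ : ℝ, 0 ≤ ρ → |(P.dVx ρ + P.dVc ρ) * ρ| ≤ M * (1 + ρ))
    (hΛ : P.α = 0 → TDKS.MemL2H2 P.Λ)
    (Ψ Υ : TDKS.X N Ω T) (hΨ : P.IsWeakSolution Ψ) (hΥ : P.IsWeakSolution Υ) :
    Ψ = Υ := by
  obtain ⟨C₁, hC₁, hext⟩ := P.norm_sp_Vext_sub_le hV0 hVu
  have huI : Integrable (fun t => C₁ * (1 + |P.u t|)) (muT T) :=
    ((integrable_const 1).add (hu.1.integrable one_le_two).norm).const_mul C₁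
  rcases hα with hα | hα
  -- the adjoint equation
  · obtain ⟨M, hM⟩ := hdVxc hα
    have hM0 : 0 ≤ M := by simpa using (abs_nonneg _).trans (hM 0 le_rfl)
    obtain ⟨C, hC0, hC⟩ := exists_abs_le_of_abs_deriv_mul_le (hVx.add hVc) hM
    obtain ⟨h, hh⟩ := hΛ hα
    have hSI : Integrable (fun t => 12 * ‖P.Λ t‖ ^ 2 + ∑ i, ‖h i i t‖ ^ 2) (muT T) :=
      ((integrable_norm_sq_coe P.Λ).const_mul 12).add
        (integrable_finsetSum _ fun i _ => integrable_norm_sq_coe (h i i))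
    refine P.eq_of_isWeakSolution hΩ hT hΨ hΥ
      (k := fun t => C₁ * (1 + |P.u t|)
        + (2 * ‖P.Λ t‖ ^ 2 + C * (1 + (12 * ‖P.Λ t‖ ^ 2 + ∑ i, ‖h i i t‖ ^ 2)))
        + 4 * ‖P.Λ t‖ ^ 2 + 2 * (M * (1 + (12 * ‖P.Λ t‖ ^ 2 + ∑ i, ‖h i i t‖ ^ 2))))
      (((huI.add (((integrable_norm_sq_coe P.Λ).const_mul 2).add
        (((integrable_const 1).add hSI).const_mul C))).add
        ((integrable_norm_sq_coe P.Λ).const_mul 4)).add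
        ((((integrable_const 1).add hSI).const_mul M).const_mul 2)) (fun t => by positivity) ?_
    filter_upwards [hh] with t ht _ _ w
    set S := 12 * ‖P.Λ t‖ ^ 2 + ∑ i, ‖h i i t‖ ^ 2 with hSdef
    have hS0 : 0 ≤ S := by positivity
    -- `S` bounds `|Λ(t)|²` and is integrable in time
    have hS : ∀ᵐ x ∂(muO Ω), ‖(P.Λ t).val x‖ ^ 2 ≤ S :=
      ae_norm_sq_le hΩ hΩb (P.Λ t) (h := fun i => h i i t) fun i => (ht i i).hasWeakPartial
    have b1 := hext t (Ψ t).val (Υ t).val w.val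
    have b2 := P.norm_sp_VΛ_sub_le hΩ hΩb hVx hVc hC hC0 hS0 (P.Λ t) hS (Ψ t).val (Υ t).val w.val
    have b3 := P.norm_DH_sub_le hΩ hΩb t (Ψ t).val (Υ t).val w.val
    have b4 := P.norm_Dxc_sub_le hVx hVc hM hM0 hS0 t hS (Ψ t).val (Υ t).val w.val
    simp only [Data.B, Data.D, hα, Complex.ofReal_zero, zero_mul, sub_zero, one_mul, add_zero]
    rw [add_mul, add_mul, add_mul, add_mul, add_mul, add_mul]
    refine le_trans (le_of_eq ?_) ((norm_add_le _ _).trans (add_le_add ((norm_add_le _ _).trans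
      (add_le_add ((norm_add_le _ _).trans (add_le_add b1 b2)) b3)) b4))
    congr 1
    ring
  -- the forward equation
  · obtain ⟨K, hK⟩ := hVcb
    obtain ⟨M, hM⟩ := hdVc hα
    obtain ⟨L, hL⟩ := hVxLip hα
    have hK0 : 0 ≤ K := (abs_nonneg _).trans (hK 0 le_rfl)
    have hM0 : 0 ≤ M := (abs_nonneg _).trans (hM 0 le_rfl)
    refine P.eq_of_isWeakSolution hΩ hT hΨ hΥ
      (k := fun t => C₁ * (1 + |P.u t|) + (3 * (‖Ψ t‖ ^ 2 + ‖Υ t‖ ^ 2) + (L + (K + 2 * M))))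
      (huI.add ((((integrable_norm_sq_coe Ψ).add (integrable_norm_sq_coe Υ)).const_mul 3).add
        (integrable_const _))) (fun t => by positivity) ?_
    filter_upwards [hL Ψ Υ hΨ hΥ] with t ht hm₁ hm₂ w
    simp only [hα, one_mul] at hm₁ hm₂
    have b1 := hext t (Ψ t).val (Υ t).val w.val
    have b2 := P.norm_sp_V_sub_le hΩ hΩb hVx hVc hK hM (Ψ t) (Υ t) w.val hm₁ hm₂ ht
    simp only [Data.B, hα, Complex.ofReal_one, sub_self, zero_mul, one_mul, add_zero]
    rw [add_mul, add_mul]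
    refine le_trans (le_of_eq ?_) ((norm_add_le _ _).trans (add_le_add b1 b2))
    congr 1
    ring
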